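/- A straight-line program (SLP) is a context-free grammar with finitely many nonterminals, exactly one production $A\to u$ ($u$ a non-empty word over nonterminals and terminals) for each nonterminal $A$, and an acyclic relation "$B$ occurs in the right-hand side of $A$"; it produces exactly one word. Its size is the sum of the lengths of its right-hand sides, and $g(w)$ is the size of a smallest SLP producing $w$. RePair starts on input $w$ with the single production $S\to w$. In each round it selects a word $\gamma$, replaces a largest set of pairwise non-overlapping occurrences of $\gamma$ in all right-hand sides (from left to right) by a fresh nonterminal $X$, and adds the production $X\to\gamma$. In the maximal-string variant (Charikar et al.), $\gamma$ is a most frequent maximal string, where a word is a maximal string if it has length at least $2$, appears at least twice without overlap in the right-hand sides, and no strictly longer word appears at least as many times without overlap. In the digram variant, $\gamma$ is a word of length $2$ appearing at least twice without overlap and with the largest number of pairwise non-overlapping occurrences. The algorithm stops when no such $\gamma$ exists. Ties are broken arbitrarily. For a way $\mathcal C$ of breaking ties let $\alpha_{\mathcal C}(2,n)=\max_w|\mathcal C(w)|/g(w)$, the maximum over all words $w$ of length $n$ over a binary alphabet, where $|\mathcal C(w)|$ is the size of the grammar that is output on $w$. A binary De Bruijn sequence of order $m$ is a word $B\in\{0,1\}^*$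 of length $2^m$ such that every word of $\{0,1\}^m$ is a factor of $B$ or a suffix of $B$ followed by a prefix of $B$. For $k\ge1$ and a binary De Bruijn sequence $B$ of order $\lceil\log_2k\rceil$ that starts with $1$, let $w_k=h(B[1:k])\in\{0,1\}^{2k}$, where $h$ is the homomorphism $h(0)=01$, $h(1)=10$ and $B[1:k]$ is the prefix of length $k$, and let $$s_k=a^{w_k[1:k+1]}\,b\,a^{w_k[1:k+2]}\,b\cdots a^{w_k[1:2k-1]}\,b\,a^{w_k[1:2k]}\in\{a,b\}^*,$$ where the prefixes $w_k[1:k+i]$ of $w_k$ are read as integers in binary. Theorem. The following holds with constants that depend neither on the choice of the De Bruijn sequences nor on the way ties are broken. 1. $|s_k|\in\Theta(4^k)$ and $g(s_k)\in O(k)$. 2. For both variants of RePair: on every non-empty binary word $w$ the algorithm, with ties broken arbitrarily, computes an SLP producing $w$; every output on input $s_k$ has size $\Omega(k^2/\log k)$; and $\alpha_{\mathcal C}(2,n)\in\Omega(\log n/\log\log n)$ for every way $\mathcal C$ of breaking ties, that is, there are $c>0$ and $n_0$ such that $\alpha_{\mathcal C}(2,n)\ge c\,\log n/\log\log n$ for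 all $n\ge n_0$. -/

import Mathlib

namespace RePair

/-! ### Straight-line programs -/

/-- A grammar with terminal alphabet `α` and nonterminals `0, …, rules.length - 1`, having exactly
one production per nonterminal: the right-hand side of nonterminal `i` is the `i`-th entry of
`rules`. -/
structure Grammar (α : Type) where
  rules : List (List (Symbol α ℕ))
  start : ℕ

namespace Grammar

variable {α : Type}

/-- Nonterminal `j` occurs in the right-hand side of nonterminal `i`. -/
def Uses (G : Grammar α) (i j : ℕ) : Prop :=
  ∃ r, G.rules[i]? = some r ∧ Symbol.nonterminal j ∈ r

/-- `G` is a straight-line program: the start symbol and all symbols on right-hand sides belong to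
the grammar, right-hand sides are non-empty, and the relation `Uses` is acyclic. -/
structure IsSLP (G : Grammar α) : Prop where
  start_lt : G.start < G.rules.length
  closed : ∀ r ∈ G.rules, ∀ j, Symbol.nonterminal j ∈ r → j < G.rules.length
  rhs_ne_nil : ∀ r ∈ G.rules, r ≠ []
  acyclic : ∀ i, ¬ Relation.TransGen G.Uses i i

/-- `G.Expands u x`: the word `u` over terminals and nonterminals derives the terminal word `x`. -/
inductive Expands (G : Grammar α) : List (Symbol α ℕ) → List α → Prop
  | nil : Expands G [] []
  | terminal (a : α) {u : List (Symbol α ℕ)} {y : List α} :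
      Expands G u y → Expands G (Symbol.terminal a :: u) (a :: y)
  | nonterminal (i : ℕ) {r u : List (Symbol α ℕ)} {x y : List α} :
      G.rules[i]? = some r → Expands G r x → Expands G u y →
        Expands G (Symbol.nonterminal i :: u) (x ++ y)

/-- The start nonterminal of `G` derives `w`. For a straight-line program there is exactly one
such `w`. -/
def Produces (G : Grammar α) (w : List α) : Prop :=
  G.Expands [Symbol.nonterminal G.start] w

/-- The size: the sum of the lengths of all right-hand sides. -/
def size (G : Grammar α) : ℕ := (G.rules.map List.length).sum

/-- The trivial grammar with the single production `S → w`. -/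
def trivial (w : List α) : Grammar α := ⟨[w.map Symbol.terminal], 0⟩

end Grammar

/-- The size `g(w)` of a smallest straight-line program producing `w` (for `w ≠ []`). -/
noncomputable def smallestSize {α : Type} (w : List α) : ℕ :=
  sInf {m | ∃ G : Grammar α, G.IsSLP ∧ G.Produces w ∧ G.size = m}

/-! ### Compressors and approximation ratio -/

/-- A grammar-based compressor maps every non-empty word to a straight-line program for it. -/
def IsCompressor {α : Type} (C : List α → Grammar α) : Prop :=
  ∀ w, w ≠ [] → (C w).IsSLP ∧ (C w).Produces w

/-- The worst-case approximation ratio `α_C(k, n)` over the words of length `n` over an alphabet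
of size `k`. -/
noncomputable def approxRatio {k : ℕ} (C : List (Fin k) → Grammar (Fin k)) (n : ℕ) : ℝ :=
  ⨆ w : List.Vector (Fin k) n, ((C w.toList).size : ℝ) / (smallestSize w.toList : ℝ)

/-! ### Occurrences and replacement -/

section Occurrences

variable {β : Type} [DecidableEq β]

/-- The number of occurrences of `γ` in a word that are met when the word is scanned from left to
right and each occurrence found is skipped. This is the largest number of pairwise non-overlapping
occurrences, see `isGreatest_countOcc`. -/
def countOcc (γ : List β) : List β → ℕ
  | [] => 0
  | x :: xs =>
    if γ <+: x :: xs then countOcc γ (xs.drop (γ.length - 1)) + 1 else countOcc γ xs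
  termination_by u => u.length
  decreasing_by all_goals simp; try omega

/-- Replacement of `γ` by the symbol `X`, from left to right, in the occurrences counted by
`countOcc`. -/
def replaceOcc (γ : List β) (X : β) : List β → List β
  | [] => []
  | x :: xs =>
    if γ <+: x :: xs then X :: replaceOcc γ X (xs.drop (γ.length - 1))
    else x :: replaceOcc γ X xs
  termination_by u => u.length
  decreasing_by all_goals simp; try omega

/-- `countOcc γ u` is the largest `m` for which `u = x₀ γ x₁ γ ⋯ γ xₘ` for some words `xᵢ`, that is,
the largest number of pairwise non-overlapping occurrences of `γ` in `u`. -/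
theorem isGreatest_countOcc (γ : List β) (hγ : γ ≠ []) (u : List β) :
    IsGreatest {m | ∃ xs : List (List β), xs.length = m + 1 ∧ γ.intercalate xs = u}
      (countOcc γ u) := by
  have h0 : 0 < γ.length := List.length_pos_iff.mpr hγ
  have hcons : ∀ (x : List β) (l : List (List β)), l ≠ [] →
      γ.intercalate (x :: l) = x ++ (γ ++ γ.intercalate l) := by
    intro x l hl
    cases l with
    | nil => exact absurd rfl hl
    | cons y l => simp [List.intercalate]
  constructor
  · induction hn : u.length using Nat.strong_induction_on generalizing u with
    | _ n ih =>
    subst hn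
    cases u with
    | nil => exact ⟨[[]], by simp [countOcc], by simp [List.intercalate]⟩
    | cons x xs =>
      rw [countOcc]
      split_ifs with hp
      · obtain ⟨l, hl, hx⟩ := ih (xs.drop (γ.length - 1)).length (by simp) _ rfl
        refine ⟨[] :: l, by simp [hl], ?_⟩
        rw [hcons _ _ (by rintro rfl; simp at hl), hx]
        obtain ⟨t, ht⟩ := hp
        have : xs.drop (γ.length - 1) = t := by
          have h1 : (x :: xs).drop γ.length = t := by rw [← ht]; simp
          obtain ⟨m, hm⟩ := Nat.exists_eq_succ_of_ne_zero h0.ne'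
          rw [hm] at h1
          simpa [hm] using h1
        simp [this, ht]
      · obtain ⟨l, hl, hx⟩ := ih xs.length (by simp) _ rfl
        cases l with
        | nil => simp at hl
        | cons y l =>
          refine ⟨(x :: y) :: l, by simpa using hl, ?_⟩
          rw [← hx]
          cases l <;> simp [List.intercalate]
  · rintro m ⟨l, hl, rfl⟩
    suffices key : ∀ n : ℕ, ∀ (m : ℕ) (l : List (List β)), l.length = m + 1 →
        (γ.intercalate l).length = n → m ≤ countOcc γ (γ.intercalate l) from key _ m l hl rfl
    intro n
    induction n using Nat.strong_induction_on with
    | _ n ih =>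
    rintro m l hl rfl
    cases m with
    | zero => exact Nat.zero_le _
    | succ m =>
      obtain ⟨x, y, l, rfl⟩ : ∃ x y l', l = x :: y :: l' := by
        match l, hl with
        | x :: y :: l', _ => exact ⟨x, y, l', rfl⟩
      rw [hcons _ _ (by simp)] at ih ⊢
      set R := γ.intercalate (y :: l) with hR
      generalize hw : x ++ (γ ++ R) = w at ih
      cases w with
      | nil => simp [hγ] at hw
      | cons c cs =>
        rw [countOcc]
        split_ifs with hp
        · have hlen : x.length + (γ.length + R.length) = cs.length + 1 := by
            simpa using congrArg List.length hw
          have hsuf : R <:+ cs.drop (γ.length - 1) := by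
            have h1 : R <:+ c :: cs := ⟨x ++ γ, by rw [← hw]; simp⟩
            have h2 : cs.drop (γ.length - 1) <:+ c :: cs :=
              (List.drop_suffix _ _).trans (List.suffix_cons _ _)
            exact List.suffix_of_suffix_length_le h1 h2 (by simp; omega)
          obtain ⟨z, hz⟩ := hsuf
          have e : γ.intercalate ((z ++ y) :: l) = cs.drop (γ.length - 1) := by
            rw [← hz, hR]
            cases l <;> simp [List.intercalate]
          have := ih (cs.drop (γ.length - 1)).length (by simp) m
            ((z ++ y) :: l) (by simpa using hl) (by rw [e])
          rw [e] at this
          omega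
        · cases x with
          | nil => exact absurd ⟨R, by simpa using hw⟩ hp
          | cons d x =>
            have hcs : x ++ (γ ++ R) = cs := by simpa using (List.cons.inj hw).2
            have e : γ.intercalate (x :: y :: l) = cs := by
              rw [hcons _ _ (by simp), ← hcs]
            have := ih cs.length (by simp) (m + 1) (x :: y :: l) (by simpa using hl)
              (by rw [e])
            rwa [e] at this

end Occurrences

namespace Grammar

variable {α : Type} [DecidableEq α]

/-- The largest number of pairwise non-overlapping occurrences of `γ` in the right-hand sides. -/
def freq (G : Grammar α) (γ : List (Symbol α ℕ)) : ℕ := (G.rules.map (countOcc γ)).sum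

/-- Replace `γ` from left to right in all right-hand sides by a fresh nonterminal `X` and add the
production `X → γ`. -/
def replace (G : Grammar α) (γ : List (Symbol α ℕ)) : Grammar α :=
  ⟨G.rules.map (replaceOcc γ (Symbol.nonterminal G.rules.length)) ++ [γ], G.start⟩

/-- `γ` is a maximal string of `G`. -/
def IsMaximalString (G : Grammar α) (γ : List (Symbol α ℕ)) : Prop :=
  2 ≤ γ.length ∧ 2 ≤ G.freq γ ∧ ∀ δ : List (Symbol α ℕ), γ.length < δ.length → G.freq δ < G.freq γ

/-- `γ` is a digram that has two non-overlapping occurrences in the right-hand sides of `G`. -/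
def IsRepeatedDigram (G : Grammar α) (γ : List (Symbol α ℕ)) : Prop :=
  γ.length = 2 ∧ 2 ≤ G.freq γ

end Grammar

/-! ### RePair -/

/-- The two variants of RePair: one replaces maximal strings, the other one digrams. -/
inductive Variant
  | maximalString
  | digram

namespace Variant

variable {α : Type} [DecidableEq α]

/-- The words that the given variant may replace. -/
def Candidate : Variant → Grammar α → List (Symbol α ℕ) → Prop
  | maximalString, G, γ => G.IsMaximalString γ
  | digram, G, γ => G.IsRepeatedDigram γ

/-- One round: a most frequent candidate is replaced. Ties are broken arbitrarily. -/
def Step (v : Variant) (G H : Grammar α) : Prop :=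
  ∃ γ, v.Candidate G γ ∧ (∀ δ, v.Candidate G δ → G.freq δ ≤ G.freq γ) ∧ H = G.replace γ

/-- `G` is a possible output on input `w`: it is reached from the trivial grammar for `w` by rounds
of the algorithm, and no candidate is left. -/
def Output (v : Variant) (w : List α) (G : Grammar α) : Prop :=
  Relation.ReflTransGen v.Step (Grammar.trivial w) G ∧ ∀ γ, ¬ v.Candidate G γ

/-- `C` computes the given variant of RePair, with some way of breaking ties. -/
def Implements (v : Variant) (C : List α → Grammar α) : Prop :=
  ∀ w, w ≠ [] → v.Output w (C w)

end Variant

/-! ### The words `s_k` -/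

/-- Binary De Bruijn sequence of order `n`. -/
def IsDeBruijn (n : ℕ) (B : List Bool) : Prop :=
  B.length = 2 ^ n ∧
    ∀ u : List Bool, u.length = n →
      u <:+: B ∨ ∃ x y : List Bool, x <:+ B ∧ y <+: B ∧ u = x ++ y

/-- The homomorphism `h` with `h(0) = 01` and `h(1) = 10`. -/
def morph (u : List Bool) : List Bool := u.flatMap fun c => [c, !c]

/-- The number with binary representation `u`, most significant bit first. -/
def binVal (u : List Bool) : ℕ := u.foldl (fun m c => 2 * m + c.toNat) 0

/-- The word `w_k = h(B[1:k])`. -/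
def wWord (k : ℕ) (B : List Bool) : List Bool := morph (B.take k)

/-- The block `a^m`, where the letters `a, b` are `0, 1 : Fin 2`. -/
def aBlock (m : ℕ) : List (Fin 2) := List.replicate m 0

/-- The word `s_k`, the blocks `a^{w_k[1:k+i]}` for `i = 1, …, k`, separated by `b`. -/
def sWord (k : ℕ) (B : List Bool) : List (Fin 2) :=
  ((List.range (k - 1)).flatMap fun i => aBlock (binVal ((wWord k B).take (k + (i + 1)))) ++ [1]) ++
    aBlock (binVal (wWord k B))

end RePair

/-!
RePair outputs straight-line programs because each round preserves derivations and acyclicity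
(`Grammar.Sound.replace`), and it terminates because the sum of the numbers `|r| - 1` over all
right-hand sides `r` decreases (`Grammar.excess_replace_lt`).

The lengths of the unary blocks of `s_k` are the binary numbers `w_k[1:k+i]`, and each of them
arises from the previous one by doubling and adding a digit. So all blocks are computed by `O(k)`
productions (`Build.exists_bitVal`), and `O(k)` more symbols join them.

RePair, however, treats all blocks alike. As long as the blocks are long, the word `XX`, where `X`
derives `a^(2^j)`, is strictly more frequent than any other word, because every symbol other than
`X` occurs at most about once per block (`freq_phaseGrammar_lt`). Therefore both variants and all
ways of breaking ties agree on the first `k` rounds (`Variant.Output.reach_phaseGrammar`). After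
these rounds a block consists of a power of one symbol, followed by one symbol for each digit `1`
among the last `k` digits of its length. These are `Θ(k²)` symbols in all. A nonterminal that is
introduced later expands to a word with two disjoint occurrences in this word
(`Covering.replace`). Thus it contains no factor that occurs only once, and if there are `N`
disjoint factors of this kind, then the start production needs at least `N` symbols in order to cut
each of them (`HasFactors.length_le`, `Variant.Output.length_le_size`).

Such factors come from windows of digits. If the digits of a window in one block agree with those
of another block at the same position, then `w_k` has a repeated factor, since the digits of the
blocks are shifted against each other. The distinct windows of a De Bruijn sequence and the
homomorphism `h` exclude this for windows of length `O(log k)` (`IsDeBruijn.distinct`,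
`hasDistinctWindows_morphSeq`), and `h` also ensures that every window contains enough digits `1`
to determine it. This gives `Ω(k · k / log k)` disjoint factors
(`HasDistinctWindows.output_size_ge`).

For the approximation ratio at an arbitrary length `n`, one further block `a^r` is put in front to
adjust the length. At each position of a window at most one of the other blocks can share its
window with this block, so only `O(k / log k)` of the factors are lost. The proof only uses that
windows of length `O(log k)` are distinct, so an explicit sequence (`counterSeq`) takes the place of
a De Bruijn sequence here.
-/

namespace RePair

/-! ### Factors and occurrences -/

section Factors

variable {β : Type}

/-- The words of `us` occur in `T` in the given order and pairwise without overlap. In particular,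
`HasFactors [e, e] T` says that `e` has two non-overlapping occurrences in `T`. -/
def HasFactors : List (List β) → List β → Prop
  | [], _ => True
  | u :: us, T => ∃ z t, T = z ++ (u ++ t) ∧ HasFactors us t

theorem HasFactors.prepend {us : List (List β)} {t : List β} (h : HasFactors us t) (z : List β) :
    HasFactors us (z ++ t) := by
  cases us with
  | nil => trivial
  | cons u us =>
    obtain ⟨z', t', rfl, h'⟩ := h
    exact ⟨z ++ z', t', by simp, h'⟩

theorem HasFactors.append {us vs : List (List β)} {x y : List β} (hx : HasFactors us x)
    (hy : HasFactors vs y) : HasFactors (us ++ vs) (x ++ y) := by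
  induction us generalizing x with
  | nil => exact hy.prepend x
  | cons u us ih =>
    obtain ⟨z, t, rfl, h⟩ := hx
    exact ⟨z, t ++ y, by simp, ih h⟩

theorem HasFactors.of_append_left {us : List (List β)} {x : List β} (hx : HasFactors us x)
    (y : List β) : HasFactors us (x ++ y) := by
  simpa using hx.append (vs := []) (y := y) True.intro

theorem hasFactors_self (u : List β) : HasFactors [u] u := ⟨[], [], by simp, True.intro⟩

theorem hasFactors_of_infix {u T : List β} (h : u <:+: T) : HasFactors [u] T := by
  obtain ⟨x, y, rfl⟩ := h
  exact ⟨x, y, by simp, True.intro⟩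

theorem HasFactors.infix_of_mem {us : List (List β)} {T u : List β} (h : HasFactors us T)
    (hu : u ∈ us) : u <:+: T := by
  induction us generalizing T with
  | nil => simp at hu
  | cons v us ih =>
    obtain ⟨z, t, rfl, h'⟩ := h
    rcases List.mem_cons.1 hu with rfl | hu
    · exact ⟨z, t, by simp⟩
    · obtain ⟨x, y, rfl⟩ := ih h' hu
      exact ⟨z ++ (v ++ x), y, by simp⟩

theorem HasFactors.two_mono {e e' T : List β} (h : HasFactors [e, e] T) (he : e' <:+: e) :
    HasFactors [e', e'] T := by
  obtain ⟨x, y, rfl⟩ := he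
  obtain ⟨z, t, rfl, z', t', rfl, -⟩ := h
  exact ⟨z ++ x, y ++ (z' ++ (x ++ (e' ++ (y ++ t')))), by simp, y ++ z' ++ x, y ++ t', by simp,
    True.intro⟩

theorem HasFactors.flatMap {γ : Type} {us : List (List β)} {T : List β} (h : HasFactors us T)
    (φ : β → List γ) : HasFactors (us.map fun u => u.flatMap φ) (T.flatMap φ) := by
  induction us generalizing T with
  | nil => trivial
  | cons u us ih =>
    obtain ⟨z, t, rfl, h'⟩ := h
    exact ⟨z.flatMap φ, t.flatMap φ, by simp, ih h'⟩

/-- If a word is cut into pieces none of which contains one of the disjoint factors `us`, then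
every word of `us` is cut somewhere, so there are at least as many pieces as factors. -/
theorem HasFactors.length_le {us es : List (List β)} (h : HasFactors us es.flatten)
    (h0 : ∀ u ∈ us, u ≠ []) (hn : ∀ u ∈ us, ∀ e ∈ es, ¬ u <:+: e) : us.length ≤ es.length := by
  induction es generalizing us with
  | nil =>
    cases us with
    | nil => simp
    | cons u us =>
      obtain ⟨z, t, h, -⟩ := h
      simp at h
      exact absurd h.2.1 (h0 u (by simp))
  | cons e es ih =>
    cases us with
    | nil => simp
    | cons u us =>
      obtain ⟨z, t, hz, ht⟩ := h
      rw [List.flatten_cons] at hz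
      rcases List.append_eq_append_iff.1 hz with ⟨a, rfl, ha⟩ | ⟨c, rfl, hc⟩
      · have := ih (us := u :: us) ⟨a, t, ha, ht⟩ h0
          fun u hu e he => hn u hu e (List.mem_cons_of_mem _ he)
        simp at this ⊢
        omega
      · rcases List.append_eq_append_iff.1 hc with ⟨a, rfl, -⟩ | ⟨c', rfl, hc'⟩
        · exact absurd ⟨z, a, by simp⟩ (hn u (by simp) (z ++ (u ++ a)) (by simp))
        · -- the piece ends within `u`: it is charged to `u` and cuts no later word of `us`
          have := ih (us := us) (by rw [hc']; exact ht.prepend c')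
            (fun u hu => h0 u (by simp [hu]))
            fun u hu e he => hn u (by simp [hu]) e (by simp [he])
          simpa using this

/-- A factor without the separator `b` lies on one side of each occurrence of `b`. -/
theorem infix_append_cons {b : β} {u x y : List β} (hb : b ∉ u) (h : u <:+: x ++ b :: y) :
    u <:+: x ∨ u <:+: y := by
  obtain ⟨p, q, h⟩ := h
  rw [List.append_assoc] at h
  rcases List.append_eq_append_iff.1 h with ⟨a, rfl, ha⟩ | ⟨c, rfl, hc⟩
  · rcases List.append_eq_append_iff.1 ha with ⟨a', rfl, -⟩ | ⟨c', rfl, hc'⟩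
    · exact Or.inl ⟨p, a', by simp⟩
    · cases c' with
      | nil => exact Or.inl ⟨p, [], by simp⟩
      | cons d c' =>
        simp only [List.cons_append, List.cons.injEq] at hc'
        exact absurd (by simp [hc'.1]) hb
  · cases c with
    | nil =>
      simp only [List.nil_append] at hc
      cases u with
      | nil => exact Or.inl ⟨[], x, by simp⟩
      | cons d u =>
        simp only [List.cons_append, List.cons.injEq] at hc
        exact absurd (by simp [hc.1]) hb
    | cons d c =>
      simp only [List.cons_append, List.cons.injEq] at hc
      exact Or.inr ⟨c, q, by simp [hc.2]⟩

/-- Two disjoint occurrences of a factor without the separator `b` lie on the same side or on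
different sides of a given occurrence of `b`. -/
theorem hasFactors_two_append_cons {b : β} {u x y : List β} (hb : b ∉ u)
    (h : HasFactors [u, u] (x ++ b :: y)) :
    HasFactors [u, u] x ∨ HasFactors [u, u] y ∨ u <:+: x ∧ u <:+: y := by
  obtain ⟨z, t, h, ht⟩ := h
  have ht' : u <:+: t := ht.infix_of_mem (by simp)
  rcases List.append_eq_append_iff.1 h with ⟨a, rfl, ha⟩ | ⟨c, rfl, hc⟩
  · cases a with
    | nil =>
      simp only [List.nil_append] at ha
      cases u with
      | nil => exact Or.inl ⟨[], x, by simp, [], x, by simp, True.intro⟩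
      | cons d u =>
        simp only [List.cons_append, List.cons.injEq] at ha
        exact absurd (by simp [ha.1]) hb
    | cons d a =>
      simp only [List.cons_append, List.cons.injEq] at ha
      exact Or.inr (Or.inl ⟨a, t, ha.2, ht⟩)
  · rcases List.append_eq_append_iff.1 hc with ⟨a, rfl, rfl⟩ | ⟨c', rfl, hc'⟩
    · rcases infix_append_cons hb ht' with h | h
      · exact Or.inl ⟨z, a, by simp, hasFactors_of_infix h⟩
      · exact Or.inr (Or.inr ⟨⟨z, a, by simp⟩, h⟩)
    · cases c' with
      | nil =>
        simp only [List.nil_append] at hc'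
        subst hc'
        have : c ++ [] <:+: [] ++ b :: y := by simpa using ht'
        rcases infix_append_cons hb this with h | h
        · have hu : c ++ [] = [] := List.eq_nil_of_infix_nil h
          rw [hu]
          exact Or.inl ⟨[], _, rfl, [], _, rfl, True.intro⟩
        · exact Or.inr (Or.inr ⟨⟨z, [], by simp⟩, h⟩)
      | cons d c' =>
        simp only [List.cons_append, List.cons.injEq] at hc'
        exact absurd (by simp [hc'.1]) hb

end Factors

section Replacement

variable {β : Type} [DecidableEq β]

theorem countOcc_nil (γ : List β) : countOcc γ [] = 0 := by rw [countOcc]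

theorem countOcc_append_self {γ : List β} (hγ : γ ≠ []) (t : List β) :
    countOcc γ (γ ++ t) = countOcc γ t + 1 := by
  cases γ with
  | nil => exact absurd rfl hγ
  | cons c γ => simp [countOcc]

theorem countOcc_cons_of_not {γ : List β} {x : β} {u : List β} (h : ¬ γ <+: x :: u) :
    countOcc γ (x :: u) = countOcc γ u := by
  rw [countOcc, if_neg h]

theorem replaceOcc_nil (γ : List β) (X : β) : replaceOcc γ X [] = [] := by rw [replaceOcc]

theorem replaceOcc_append_self {γ : List β} (hγ : γ ≠ []) (X : β) (t : List β) :
    replaceOcc γ X (γ ++ t) = X :: replaceOcc γ X t := by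
  cases γ with
  | nil => exact absurd rfl hγ
  | cons c γ => simp [replaceOcc]

theorem replaceOcc_cons_of_not {γ : List β} {x : β} {u : List β} (X : β) (h : ¬ γ <+: x :: u) :
    replaceOcc γ X (x :: u) = x :: replaceOcc γ X u := by
  rw [replaceOcc, if_neg h]

/-- Induction along the scan from left to right that `countOcc` and `replaceOcc` perform. -/
theorem occ_induction {γ : List β} (hγ : γ ≠ []) {P : List β → Prop} (nil : P [])
    (occ : ∀ t, P t → P (γ ++ t)) (skip : ∀ x u, ¬ γ <+: x :: u → P u → P (x :: u)) (u : List β) :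
    P u := by
  induction hn : u.length using Nat.strong_induction_on generalizing u with
  | _ n ih =>
    cases u with
    | nil => exact nil
    | cons x u =>
      by_cases h : γ <+: x :: u
      · obtain ⟨t, ht⟩ := h
        rw [← ht]
        refine occ t (ih t.length ?_ t rfl)
        have h0 := List.length_pos_iff.2 hγ
        have := congrArg List.length ht
        rw [List.length_append] at this
        omega
      · exact skip x u h (ih u.length (by simp at hn; omega) u rfl)

theorem hasFactors_replicate_countOcc {γ : List β} (hγ : γ ≠ []) (u : List β) :
    HasFactors (List.replicate (countOcc γ u) γ) u := by
  induction u using occ_induction hγ with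
  | nil => simp [countOcc_nil, HasFactors]
  | occ t ih =>
    rw [countOcc_append_self hγ]
    exact ⟨[], t, rfl, ih⟩
  | skip x u h ih =>
    rw [countOcc_cons_of_not h]
    exact ih.prepend [x]

theorem infix_of_countOcc_pos {γ : List β} (hγ : γ ≠ []) {u : List β} (h : 0 < countOcc γ u) :
    γ <:+: u :=
  (hasFactors_replicate_countOcc hγ u).infix_of_mem (by simp; omega)

theorem hasFactors_two_of_countOcc {γ : List β} (hγ : γ ≠ []) {u : List β}
    (h : 2 ≤ countOcc γ u) : HasFactors [γ, γ] u := by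
  obtain ⟨m, hm⟩ := Nat.exists_eq_add_of_le h
  have := hasFactors_replicate_countOcc hγ u
  rw [hm, List.replicate_add] at this
  obtain ⟨z, t, rfl, z', t', rfl, -⟩ := this
  exact ⟨z, _, rfl, z', t', rfl, True.intro⟩

theorem count_mul_countOcc_le {γ : List β} (hγ : γ ≠ []) (y : β) (u : List β) :
    countOcc γ u * γ.count y ≤ u.count y := by
  induction u using occ_induction hγ with
  | nil => simp [countOcc_nil]
  | occ t ih => rw [countOcc_append_self hγ, List.count_append, Nat.add_mul]; omega
  | skip x u h ih => rw [countOcc_cons_of_not h, List.count_cons]; omega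

theorem length_replaceOcc {γ : List β} (hγ : γ ≠ []) (X : β) (u : List β) :
    (replaceOcc γ X u).length + countOcc γ u * γ.length = u.length + countOcc γ u := by
  induction u using occ_induction hγ with
  | nil => simp [countOcc_nil, replaceOcc_nil]
  | occ t ih =>
    rw [countOcc_append_self hγ, replaceOcc_append_self hγ, List.length_append, List.length_cons,
      Nat.add_mul]
    omega
  | skip x u h ih =>
    rw [countOcc_cons_of_not h, replaceOcc_cons_of_not X h, List.length_cons, List.length_cons]
    omega

theorem countOcc_le_length {γ : List β} (hγ : γ ≠ []) (u : List β) :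
    countOcc γ u ≤ u.length := by
  induction u using occ_induction hγ with
  | nil => simp [countOcc_nil]
  | occ t ih =>
    have := List.length_pos_iff.2 hγ
    rw [countOcc_append_self hγ, List.length_append]
    omega
  | skip x u h ih => rw [countOcc_cons_of_not h, List.length_cons]; omega

theorem replaceOcc_ne_nil {γ : List β} (hγ : γ ≠ []) (X : β) {u : List β} (hu : u ≠ []) :
    replaceOcc γ X u ≠ [] := by
  cases u with
  | nil => exact absurd rfl hu
  | cons x u =>
    by_cases h : γ <+: x :: u
    · obtain ⟨t, ht⟩ := h
      rw [← ht, replaceOcc_append_self hγ]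
      simp
    · simp [replaceOcc_cons_of_not X h]

theorem replaceOcc_eq_self {γ : List β} (hγ : γ ≠ []) (X : β) {u : List β}
    (h : countOcc γ u = 0) : replaceOcc γ X u = u := by
  induction u using occ_induction hγ with
  | nil => exact replaceOcc_nil γ X
  | occ t ih => rw [countOcc_append_self hγ] at h; omega
  | skip x u hx ih =>
    rw [countOcc_cons_of_not hx] at h
    rw [replaceOcc_cons_of_not X hx, ih h]

theorem mem_replaceOcc {γ : List β} (hγ : γ ≠ []) {X y : β} {u : List β}
    (h : y ∈ replaceOcc γ X u) : y ∈ u ∨ y = X ∧ γ <:+: u := by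
  induction u using occ_induction hγ with
  | nil => simp [replaceOcc_nil] at h
  | occ t ih =>
    rw [replaceOcc_append_self hγ, List.mem_cons] at h
    rcases h with rfl | h
    · exact Or.inr ⟨rfl, [], t, by simp⟩
    · rcases ih h with h | ⟨hy, p, q, rfl⟩
      · exact Or.inl (by simp [h])
      · exact Or.inr ⟨hy, γ ++ p, q, by simp⟩
  | skip x u hx ih =>
    rw [replaceOcc_cons_of_not X hx, List.mem_cons] at h
    rcases h with rfl | h
    · simp
    · rcases ih h with h | ⟨hy, p, q, rfl⟩
      · exact Or.inl (by simp [h])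
      · exact Or.inr ⟨hy, x :: p, q, by simp⟩

theorem count_replaceOcc {γ : List β} (hγ : γ ≠ []) {X : β} {u : List β} (hX : X ∉ u) :
    (replaceOcc γ X u).count X = countOcc γ u := by
  induction u using occ_induction hγ with
  | nil => simp [countOcc_nil, replaceOcc_nil]
  | occ t ih =>
    rw [countOcc_append_self hγ, replaceOcc_append_self hγ, List.count_cons_self,
      ih (by simp at hX; exact hX.2)]
  | skip x u hx ih =>
    simp only [List.mem_cons, not_or] at hX
    rw [countOcc_cons_of_not hx, replaceOcc_cons_of_not X hx,
      List.count_cons_of_ne (Ne.symm hX.1), ih hX.2]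

/-- Mapping the new symbol to the image of `γ` undoes the replacement. -/
theorem flatMap_replaceOcc {δ : Type} {γ : List β} (hγ : γ ≠ []) {X : β} {u : List β} (hX : X ∉ u)
    (φ : β → List δ) :
    (replaceOcc γ X u).flatMap (Function.update φ X (γ.flatMap φ)) = u.flatMap φ := by
  induction u using occ_induction hγ with
  | nil => simp [replaceOcc_nil]
  | occ t ih =>
    rw [replaceOcc_append_self hγ, List.flatMap_cons, List.flatMap_append,
      ih (by simp at hX; exact hX.2), Function.update_self]
  | skip x u hx ih =>
    simp only [List.mem_cons, not_or] at hX
    rw [replaceOcc_cons_of_not X hx, List.flatMap_cons, List.flatMap_cons, ih hX.2,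
      Function.update_of_ne (Ne.symm hX.1)]

/-- A run of `s` is halved by the replacement of `ss`. -/
theorem replaceOcc_replicate_append (s X : β) (n : ℕ) {v : List β} (hv : s ∉ v) :
    replaceOcc [s, s] X (List.replicate n s ++ v) =
      List.replicate (n / 2) X ++ (List.replicate (n % 2) s ++ v) := by
  have key : ∀ u : List β, s ∉ u → replaceOcc [s, s] X u = u := by
    intro u hu
    refine replaceOcc_eq_self (by simp) X (Nat.eq_zero_of_not_pos fun h => hu ?_)
    exact (infix_of_countOcc_pos (by simp) h).subset (by simp)
  induction n using Nat.strong_induction_on with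
  | _ n ih =>
    match n, ih with
    | 0, _ => simpa using key v hv
    | 1, _ =>
      have h : ¬ [s, s] <+: s :: v := by
        rintro ⟨t, ht⟩
        simp at ht
        exact hv (by simp [← ht])
      simp [replaceOcc_cons_of_not X h, key v hv]
    | n + 2, ih =>
      have e : List.replicate (n + 2) s ++ v = [s, s] ++ (List.replicate n s ++ v) := by
        simp [List.replicate_succ]
      rw [e, replaceOcc_append_self (by simp), ih n (by omega)]
      have h1 : (n + 2) / 2 = n / 2 + 1 := by omega
      have h2 : (n + 2) % 2 = n % 2 := by omega
      rw [h1, h2, List.replicate_succ, List.cons_append]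

end Replacement

/-! ### RePair computes straight-line programs -/

namespace Grammar

variable {α : Type}

/-- All nonterminals on right-hand sides belong to the grammar. -/
def Closed (G : Grammar α) : Prop :=
  ∀ r ∈ G.rules, ∀ j, Symbol.nonterminal j ∈ r → j < G.rules.length

theorem Expands.split {G : Grammar α} {u v : List (Symbol α ℕ)} {x : List α}
    (h : G.Expands (u ++ v) x) : ∃ y z, x = y ++ z ∧ G.Expands u y ∧ G.Expands v z := by
  induction u generalizing x with
  | nil => exact ⟨[], x, rfl, .nil, h⟩
  | cons c u ih =>
    cases h with
    | terminal a h =>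
      obtain ⟨y, z, rfl, hy, hz⟩ := ih h
      exact ⟨a :: y, z, rfl, .terminal a hy, hz⟩
    | nonterminal i hr hx h =>
      obtain ⟨y, z, rfl, hy, hz⟩ := ih h
      exact ⟨_ ++ y, z, by simp, .nonterminal i hr hx hy, hz⟩

/-- An invariant of RePair on input `w`. Acyclicity is witnessed by a rank that decreases from
left-hand sides to right-hand sides. -/
structure Sound (w : List α) (G : Grammar α) : Prop where
  start_lt : G.start < G.rules.length
  closed : G.Closed
  rhs_ne_nil : ∀ r ∈ G.rules, r ≠ []
  ranked : ∃ rank : ℕ → ℕ, ∀ i j, G.Uses i j → rank j < rank i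
  produces : G.Produces w

theorem isSLP_of_ranked {G : Grammar α} (h1 : G.start < G.rules.length) (h2 : G.Closed)
    (h3 : ∀ r ∈ G.rules, r ≠ []) (h4 : ∃ rank : ℕ → ℕ, ∀ i j, G.Uses i j → rank j < rank i) :
    G.IsSLP := by
  refine ⟨h1, h2, h3, ?_⟩
  obtain ⟨rank, hr⟩ := h4
  have key : ∀ i j, Relation.TransGen G.Uses i j → rank j < rank i := by
    intro i j h
    induction h with
    | single h => exact hr _ _ h
    | tail _ h ih => exact (hr _ _ h).trans ih
  exact fun i h => lt_irrefl _ (key i i h)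

theorem Sound.isSLP {w : List α} {G : Grammar α} (h : G.Sound w) : G.IsSLP :=
  isSLP_of_ranked h.start_lt h.closed h.rhs_ne_nil h.ranked

theorem expands_map_terminal (G : Grammar α) (w : List α) :
    G.Expands (w.map Symbol.terminal) w := by
  induction w with
  | nil => exact .nil
  | cons a w ih => exact .terminal a ih

theorem sound_trivial {w : List α} (hw : w ≠ []) : (Grammar.trivial w).Sound w := by
  refine ⟨by simp [Grammar.trivial], ?_, ?_, ⟨fun _ => 0, ?_⟩, ?_⟩
  · intro r hr j hj
    simp only [Grammar.trivial, List.mem_singleton] at hr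
    subst hr
    simp at hj
  · intro r hr
    simp only [Grammar.trivial, List.mem_singleton] at hr
    subst hr
    simpa using hw
  · rintro i j ⟨r, hr, hj⟩
    have := List.mem_of_getElem? hr
    simp only [Grammar.trivial, List.mem_singleton] at this
    subst this
    simp at hj
  · have := Expands.nonterminal (G := Grammar.trivial w) 0 (r := w.map Symbol.terminal) (by rfl)
      (expands_map_terminal _ w) .nil
    simpa [Produces, Grammar.trivial] using this

variable [DecidableEq α]

theorem exists_countOcc_pos {G : Grammar α} {γ : List (Symbol α ℕ)} (h : 0 < G.freq γ) :
    ∃ r ∈ G.rules, 0 < countOcc γ r := by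
  by_contra! hn
  have : G.freq γ = 0 := by
    refine List.sum_eq_zero fun x hx => ?_
    obtain ⟨r, hr, rfl⟩ := List.mem_map.1 hx
    exact Nat.le_zero.1 (hn r hr)
  omega

/-- `γ` may be abbreviated: it has at least two letters and occurs at least twice. Both variants
of RePair only replace such words. -/
def Abbreviable (G : Grammar α) (γ : List (Symbol α ℕ)) : Prop :=
  2 ≤ γ.length ∧ 2 ≤ G.freq γ

theorem Abbreviable.ne_nil {G : Grammar α} {γ : List (Symbol α ℕ)} (h : G.Abbreviable γ) :
    γ ≠ [] := by
  rintro rfl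
  exact absurd h.1 (by simp)

theorem Abbreviable.lt_of_mem {G : Grammar α} {γ : List (Symbol α ℕ)} (h : G.Abbreviable γ)
    (hG : G.Closed) {j : ℕ} (hj : Symbol.nonterminal j ∈ γ) : j < G.rules.length := by
  obtain ⟨r, hr, hc⟩ := exists_countOcc_pos (Nat.lt_of_lt_of_le Nat.zero_lt_two h.2)
  exact hG r hr j ((infix_of_countOcc_pos h.ne_nil hc).subset hj)

theorem Closed.replace {G : Grammar α} (hG : G.Closed) {γ : List (Symbol α ℕ)}
    (h : G.Abbreviable γ) : (G.replace γ).Closed := by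
  intro r hr j hj
  simp only [Grammar.replace, List.mem_append, List.mem_map, List.mem_singleton,
    List.length_append, List.length_map, List.length_singleton] at hr ⊢
  rcases hr with ⟨r, hr, rfl⟩ | rfl
  · rcases mem_replaceOcc h.ne_nil hj with hj | ⟨hj, -⟩
    · exact Nat.lt_succ_of_lt (hG r hr j hj)
    · rw [Symbol.nonterminal.inj hj]
      omega
  · exact Nat.lt_succ_of_lt (h.lt_of_mem hG hj)

theorem getElem?_replace {G : Grammar α} (γ : List (Symbol α ℕ)) {i : ℕ}
    {r : List (Symbol α ℕ)} (h : G.rules[i]? = some r) :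
    (G.replace γ).rules[i]? =
      some (replaceOcc γ (Symbol.nonterminal G.rules.length) r) := by
  obtain ⟨hi, rfl⟩ := List.getElem?_eq_some_iff.1 h
  simp [Grammar.replace, List.getElem?_append, hi]

theorem getElem?_replace_length (G : Grammar α) (γ : List (Symbol α ℕ)) :
    (G.replace γ).rules[G.rules.length]? = some γ := by
  simp [Grammar.replace]

theorem Expands.replaceOcc {H : Grammar α} {γ : List (Symbol α ℕ)} (hγ : γ ≠ [])
    {N : ℕ} (hN : H.rules[N]? = some γ) {u : List (Symbol α ℕ)} {x : List α}
    (h : H.Expands u x) : H.Expands (replaceOcc γ (Symbol.nonterminal N) u) x := by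
  induction u using occ_induction hγ generalizing x with
  | nil => rwa [replaceOcc_nil]
  | occ t ih =>
    obtain ⟨y, z, rfl, hy, hz⟩ := h.split
    rw [replaceOcc_append_self hγ]
    exact .nonterminal N hN hy (ih hz)
  | skip c u hc ih =>
    rw [replaceOcc_cons_of_not _ hc]
    cases h with
    | terminal a h => exact .terminal a (ih h)
    | nonterminal i hr hx h => exact .nonterminal i hr hx (ih h)

theorem Expands.replace {G : Grammar α} {γ : List (Symbol α ℕ)} (hγ : γ ≠ [])
    {u : List (Symbol α ℕ)} {x : List α} (h : G.Expands u x) : (G.replace γ).Expands u x := by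
  induction h with
  | nil => exact .nil
  | terminal a _ ih => exact .terminal a ih
  | nonterminal i hr _ _ ih1 ih2 =>
    exact .nonterminal i (getElem?_replace γ hr)
      (ih1.replaceOcc hγ (getElem?_replace_length G γ)) ih2

theorem Sound.replace {w : List α} {G : Grammar α} (hG : G.Sound w) {γ : List (Symbol α ℕ)}
    (h : G.Abbreviable γ) : (G.replace γ).Sound w := by
  refine ⟨?_, hG.closed.replace h, ?_, ?_, hG.produces.replace h.ne_nil⟩
  · have := hG.start_lt
    simp [Grammar.replace]
    omega
  · intro r hr
    simp only [Grammar.replace, List.mem_append, List.mem_map, List.mem_singleton] at hr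
    rcases hr with ⟨r, hr, rfl⟩ | rfl
    · exact replaceOcc_ne_nil h.ne_nil _ (hG.rhs_ne_nil r hr)
    · exact h.ne_nil
  · obtain ⟨rank, hrank⟩ := hG.ranked
    -- ranks are doubled, so that the new nonterminal fits between the symbols of `γ` and the
    -- left-hand sides of the productions in which `γ` occurs
    obtain ⟨M, hM, hM'⟩ : ∃ M, (∀ j, Symbol.nonterminal j ∈ γ → rank j < M) ∧
        ∀ i, (∀ j, Symbol.nonterminal j ∈ γ → rank j < rank i) → M ≤ rank i := by
      classical
      let S : Finset ℕ := (Finset.range G.rules.length).filter fun j => Symbol.nonterminal j ∈ γ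
      refine ⟨S.sup fun j => rank j + 1, fun j hj => ?_, fun i hi => Finset.sup_le fun j hj => ?_⟩
      · have : j ∈ S := by simpa [S] using ⟨h.lt_of_mem hG.closed hj, hj⟩
        exact Nat.lt_of_succ_le (Finset.le_sup (f := fun j => rank j + 1) this)
      · exact hi j (by simpa [S] using (Finset.mem_filter.1 hj).2)
    set N := G.rules.length with hN
    refine ⟨fun i => if i = N then 2 * M else 2 * rank i + 1, ?_⟩
    rintro i j ⟨r, hr, hj⟩
    rcases lt_trichotomy i N with hi | hi | hi
    · obtain ⟨r', hr'⟩ : ∃ r', G.rules[i]? = some r' := ⟨_, List.getElem?_eq_getElem hi⟩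
      rw [getElem?_replace γ hr'] at hr
      obtain rfl := Option.some.inj hr
      have hmem : r' ∈ G.rules := List.mem_of_getElem? hr'
      rcases mem_replaceOcc h.ne_nil hj with hj | ⟨hj, hinf⟩
      · have h1 := hG.closed r' hmem j hj
        have h2 := hrank i j ⟨r', hr', hj⟩
        simp only [hi.ne, if_false, (show j ≠ N from h1.ne)]
        omega
      · obtain rfl := Symbol.nonterminal.inj hj
        have := hM' i fun j hj => hrank i j ⟨r', hr', hinf.subset hj⟩
        simp only [hi.ne, if_false, ← hN, if_true]
        omega
    · rw [hi, hN, getElem?_replace_length] at hr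
      obtain rfl := Option.some.inj hr
      have h1 : j < N := h.lt_of_mem hG.closed hj
      have h2 := hM j hj
      simp only [hi, if_true, h1.ne, if_false]
      omega
    · rw [List.getElem?_eq_none (by simp [Grammar.replace]; omega)] at hr
      simp at hr

/-- The termination measure of RePair. The size itself need not decrease: replacing a digram that
occurs twice does not change it. -/
def excess (G : Grammar α) : ℕ := (G.rules.map fun r => r.length - 1).sum

theorem excess_replace_lt {G : Grammar α} (hG : ∀ r ∈ G.rules, r ≠ []) {γ : List (Symbol α ℕ)}
    (h : G.Abbreviable γ) : (G.replace γ).excess < G.excess := by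
  obtain ⟨l, hl⟩ : ∃ l, γ.length = l + 2 := ⟨_, (Nat.sub_add_cancel h.1).symm⟩
  have key : ∀ (X : Symbol α ℕ) (rs : List (List (Symbol α ℕ))), (∀ r ∈ rs, r ≠ []) →
      ((rs.map (replaceOcc γ X)).map fun r => r.length - 1).sum +
        (rs.map (countOcc γ)).sum * (l + 1) ≤ (rs.map fun r => r.length - 1).sum := by
    intro X rs hrs
    induction rs with
    | nil => simp
    | cons r rs ih =>
      have ih := ih fun r hr => hrs r (List.mem_cons_of_mem _ hr)
      have h1 := length_replaceOcc h.ne_nil X r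
      have h2 := List.length_pos_iff.2 (replaceOcc_ne_nil h.ne_nil X (hrs r List.mem_cons_self))
      simp only [List.map_cons, List.sum_cons]
      rw [hl] at h1
      have h3 : countOcc γ r * (l + 2) = countOcc γ r * (l + 1) + countOcc γ r := by ring
      rw [h3] at h1
      rw [Nat.add_mul]
      omega
  have := key (Symbol.nonterminal G.rules.length) G.rules hG
  have h2 : 2 * (l + 1) ≤ (G.rules.map (countOcc γ)).sum * (l + 1) :=
    Nat.mul_le_mul_right _ h.2
  simp only [excess, Grammar.replace, List.map_append, List.sum_append, List.map_cons,
    List.map_nil, List.sum_cons, List.sum_nil, hl]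
  omega

theorem freq_le_size (G : Grammar α) {γ : List (Symbol α ℕ)} (hγ : γ ≠ []) :
    G.freq γ ≤ G.size :=
  List.sum_le_sum fun r _ => countOcc_le_length hγ r

end Grammar

namespace Variant

variable {α : Type} [DecidableEq α]

theorem Candidate.abbreviable {v : Variant} {G : Grammar α} {γ : List (Symbol α ℕ)}
    (h : v.Candidate G γ) : G.Abbreviable γ := by
  cases v with
  | maximalString => exact ⟨h.1, h.2.1⟩
  | digram => exact ⟨h.1.ge, h.2⟩

theorem Step.exists_abbreviable {v : Variant} {G H : Grammar α} (h : v.Step G H) :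
    ∃ γ, G.Abbreviable γ ∧ H = G.replace γ := by
  obtain ⟨γ, hγ, -, rfl⟩ := h
  exact ⟨γ, hγ.abbreviable, rfl⟩

theorem exists_step {v : Variant} {G : Grammar α} (h : ∃ γ, v.Candidate G γ) :
    ∃ H, v.Step G H := by
  classical
  obtain ⟨γ, hγ⟩ := h
  let P : ℕ → Prop := fun m => ∃ δ, v.Candidate G δ ∧ G.freq δ = m
  have hb : ∀ δ, v.Candidate G δ → G.freq δ ≤ G.size :=
    fun δ hδ => G.freq_le_size hδ.abbreviable.ne_nil
  obtain ⟨δ, hδ, hm⟩ : P (Nat.findGreatest P G.size) :=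
    Nat.findGreatest_spec (hb γ hγ) ⟨γ, hγ, rfl⟩
  refine ⟨_, δ, hδ, fun ε hε => ?_, rfl⟩
  rw [hm]
  exact Nat.le_findGreatest (hb ε hε) ⟨ε, hε, rfl⟩

theorem exists_reach_terminal (v : Variant) {w : List α} {G : Grammar α} (hG : G.Sound w) :
    ∃ H, Relation.ReflTransGen v.Step G H ∧ ∀ γ, ¬ v.Candidate H γ := by
  induction hn : G.excess using Nat.strong_induction_on generalizing G with
  | _ n ih =>
    by_cases h : ∃ γ, v.Candidate G γ
    · obtain ⟨H, hH⟩ := exists_step h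
      obtain ⟨γ, hγ, rfl⟩ := hH.exists_abbreviable
      obtain ⟨K, hK, hK'⟩ := ih _ (hn ▸ Grammar.excess_replace_lt hG.rhs_ne_nil hγ)
        (hG.replace hγ) rfl
      exact ⟨K, .head hH hK, hK'⟩
    · exact ⟨G, .refl, not_exists.1 h⟩

theorem exists_implements (v : Variant) : ∃ C : List α → Grammar α, v.Implements C := by
  have : ∀ w : List α, ∃ G, w ≠ [] → v.Output w G := by
    intro w
    by_cases hw : w = []
    · exact ⟨Grammar.trivial w, fun h => absurd hw h⟩
    · obtain ⟨G, hG⟩ := v.exists_reach_terminal (Grammar.sound_trivial hw)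
      exact ⟨G, fun _ => hG⟩
  choose C hC using this
  exact ⟨C, hC⟩

theorem sound_of_reach {v : Variant} {w : List α} {G H : Grammar α} (hG : G.Sound w)
    (h : Relation.ReflTransGen v.Step G H) : H.Sound w := by
  induction h with
  | refl => exact hG
  | tail _ h ih =>
    obtain ⟨γ, hγ, rfl⟩ := h.exists_abbreviable
    exact ih.replace hγ

theorem Implements.isCompressor {v : Variant} {C : List α → Grammar α} (h : v.Implements C) :
    IsCompressor C := fun w hw =>
  have := sound_of_reach (Grammar.sound_trivial hw) (h w hw).1
  ⟨this.isSLP, this.produces⟩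

end Variant

/-! ### Upper bounds for the smallest grammar -/

/-- `Build vs s`: the words of `vs` can be computed one after the other, each as a concatenation
of single letters and words computed before, where `s` is the total number of factors used. The
most recent word comes first. -/
inductive Build {α : Type} : List (List α) → ℕ → Prop
  | nil : Build [] 0
  | step {vs : List (List α)} {s : ℕ} (parts : List (List α)) : Build vs s → parts ≠ [] →
      (∀ p ∈ parts, p ∈ vs ∨ ∃ a, p = [a]) → Build (parts.flatten :: vs) (s + parts.length)

theorem Grammar.Expands.append {α : Type} {G : Grammar α} {u v : List (Symbol α ℕ)}
    {x y : List α} (hu : G.Expands u x) (hv : G.Expands v y) : G.Expands (u ++ v) (x ++ y) := by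
  induction hu with
  | nil => exact hv
  | terminal a _ ih => exact .terminal a ih
  | nonterminal i hr hx _ _ ih =>
    rw [List.append_assoc]
    exact .nonterminal i hr hx ih

/-- The productions read off from a straight-line computation. The quantification over the further
productions `E` makes the derivations stable under extension of the grammar. -/
theorem Build.exists_rules {α : Type} {vs : List (List α)} {s : ℕ} (h : Build vs s) :
    ∃ rules : List (List (Symbol α ℕ)), (rules.map List.length).sum = s ∧
      (∀ r ∈ rules, r ≠ []) ∧
      (∀ (i : ℕ) (r : List (Symbol α ℕ)), rules[i]? = some r →
        ∀ j, Symbol.nonterminal j ∈ r → j < i) ∧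
      ∀ p ∈ vs, ∃ i : ℕ, i < rules.length ∧ ∀ E st,
        (Grammar.mk (rules ++ E) st).Expands [Symbol.nonterminal i] p := by
  induction h with
  | nil => exact ⟨[], by simp⟩
  | @step vs s parts _ hne hp ih =>
    obtain ⟨rules, hs, h1, h2, h3⟩ := ih
    have key : ∀ ps : List (List α), (∀ p ∈ ps, p ∈ vs ∨ ∃ a, p = [a]) →
        ∃ r : List (Symbol α ℕ), r.length = ps.length ∧
          (∀ j, Symbol.nonterminal j ∈ r → j < rules.length) ∧
          ∀ E st, (Grammar.mk (rules ++ E) st).Expands r ps.flatten := by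
      intro ps
      induction ps with
      | nil => exact fun _ => ⟨[], rfl, by simp, fun _ _ => .nil⟩
      | cons p ps ih =>
        intro hps
        obtain ⟨r, hr, hr1, hr2⟩ := ih fun q hq => hps q (List.mem_cons_of_mem _ hq)
        rcases hps p List.mem_cons_self with hpv | ⟨a, rfl⟩
        · obtain ⟨i, hi, hi2⟩ := h3 p hpv
          refine ⟨Symbol.nonterminal i :: r, by simp [hr], fun j hj => ?_, fun E st => ?_⟩
          · rcases List.mem_cons.1 hj with hj | hj
            · exact Symbol.nonterminal.inj hj ▸ hi
            · exact hr1 j hj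
          · exact (hi2 E st).append (hr2 E st)
        · refine ⟨Symbol.terminal a :: r, by simp [hr], fun j hj => ?_, fun E st => ?_⟩
          · exact hr1 j (by simpa using hj)
          · exact .terminal a (hr2 E st)
    obtain ⟨r, hr, hr1, hr2⟩ := key parts hp
    refine ⟨rules ++ [r], by simp [hs, hr], ?_, ?_, ?_⟩
    · intro q hq
      rcases List.mem_append.1 hq with hq | hq
      · exact h1 q hq
      · rw [List.mem_singleton.1 hq]
        rintro rfl
        exact hne (List.length_eq_zero_iff.1 hr.symm)
    · intro i q hq j hj
      rw [List.getElem?_append] at hq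
      split_ifs at hq with hi
      · exact h2 i q hq j hj
      · rcases Nat.eq_zero_or_pos (i - rules.length) with h0 | h0
        · rw [h0] at hq
          obtain rfl := Option.some.inj hq
          have := hr1 j hj
          omega
        · rw [List.getElem?_eq_none (show [r].length ≤ i - rules.length from h0)] at hq
          simp at hq
    · intro p hpm
      rcases List.mem_cons.1 hpm with rfl | hpm
      · refine ⟨rules.length, by simp, fun E st => ?_⟩
        rw [← List.append_nil parts.flatten]
        refine .nonterminal _ (r := r) (by simp) ?_ .nil
        rw [List.append_assoc]
        exact hr2 _ st
      · obtain ⟨i, hi, hi2⟩ := h3 p hpm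
        refine ⟨i, by simp; omega, fun E st => ?_⟩
        rw [List.append_assoc]
        exact hi2 _ st

theorem Build.smallestSize_le {α : Type} {vs : List (List α)} {s : ℕ} (h : Build vs s)
    {w : List α} (hw : w ∈ vs) : smallestSize w ≤ s := by
  obtain ⟨rules, hs, h1, h2, h3⟩ := h.exists_rules
  obtain ⟨i, hi, hi2⟩ := h3 w hw
  refine Nat.sInf_le ⟨⟨rules, i⟩, Grammar.isSLP_of_ranked hi ?_ h1 ⟨id, ?_⟩, ?_, hs⟩
  · intro r hr j hj
    obtain ⟨n, hn⟩ := List.getElem?_of_mem hr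
    have h4 := h2 n r hn j hj
    have h5 := (List.getElem?_eq_some_iff.1 hn).1
    exact h4.trans h5
  · rintro i j ⟨r, hr, hj⟩
    exact h2 i r hr j hj
  · simpa [Grammar.Produces] using hi2 [] i

theorem smallestSize_pos {α : Type} {w : List α} (hw : w ≠ []) : 0 < smallestSize w := by
  have hne : {m | ∃ G : Grammar α, G.IsSLP ∧ G.Produces w ∧ G.size = m}.Nonempty :=
    ⟨_, Grammar.trivial w, (Grammar.sound_trivial hw).isSLP, (Grammar.sound_trivial hw).produces,
      rfl⟩
  obtain ⟨G, hG, -, hs⟩ := Nat.sInf_mem hne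
  unfold smallestSize
  rw [← hs, Grammar.size]
  have hmem := List.getElem_mem hG.start_lt
  have h1 := List.length_pos_iff.2 (hG.rhs_ne_nil _ hmem)
  have h2 := List.single_le_sum (fun _ _ => Nat.zero_le _) _
    (List.mem_map_of_mem (f := List.length) hmem)
  omega

theorem aBlock_add (m n : ℕ) : aBlock (m + n) = aBlock m ++ aBlock n := List.replicate_add ..

/-- One step of the binary method for unary words. -/
theorem Build.double {vs : List (List (Fin 2))} {s m : ℕ} (h : Build vs s) (hm : aBlock m ∈ vs)
    (c : Bool) : ∃ s' ≤ s + 3, Build (aBlock (2 * m + c.toNat) :: vs) s' := by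
  cases c with
  | false =>
    refine ⟨s + 2, by omega, ?_⟩
    have := h.step [aBlock m, aBlock m] (by simp) (by simp [hm])
    rw [show aBlock (2 * m + false.toNat) = [aBlock m, aBlock m].flatten by
      simp [two_mul, aBlock_add]]
    exact this
  | true =>
    refine ⟨s + 3, le_rfl, ?_⟩
    have := h.step [aBlock m, aBlock m, [0]] (by simp) (by simp [hm])
    rw [show aBlock (2 * m + true.toNat) = [aBlock m, aBlock m, [0]].flatten by
      simp only [two_mul, aBlock_add, List.flatten_cons, List.append_assoc]; rfl]
    exact this

theorem Build.one {vs : List (List (Fin 2))} {s : ℕ} (h : Build vs s) :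
    ∃ s' ≤ s + 3, Build (aBlock 1 :: vs) s' :=
  ⟨s + 1, by omega, h.step [[0]] (by simp) (by simp)⟩

theorem Build.exists_aBlock {vs : List (List (Fin 2))} {s : ℕ} (h : Build vs s) {n r : ℕ}
    (hr : 0 < r) (hn : r < 2 ^ n) :
    ∃ vs' s', Build vs' s' ∧ s' ≤ s + 3 * n ∧ vs ⊆ vs' ∧ aBlock r ∈ vs' := by
  induction n generalizing r with
  | zero => simp at hn; omega
  | succ n ih =>
    rcases Nat.lt_or_ge r 2 with h2 | h2
    · obtain rfl : r = 1 := by omega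
      obtain ⟨s', hs', hb⟩ := h.one
      exact ⟨_, s', hb, by omega, by simp, by simp⟩
    · obtain ⟨vs', s', hb, hs, hv, hr'⟩ :=
        ih (r := r / 2) (by omega) (by rw [pow_succ] at hn; omega)
      obtain ⟨s'', hs', hb'⟩ := hb.double hr' (r % 2 == 1)
      refine ⟨_, s'', hb', by omega, fun x hx => List.mem_cons_of_mem _ (hv hx), ?_⟩
      have : 2 * (r / 2) + (r % 2 == 1).toNat = r := by
        rcases Nat.mod_two_eq_zero_or_one r with h | h <;> simp [h] <;> omega
      simp [this]

/-- The number whose binary representation consists of the first `n` values of `f`, most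
significant bit first. -/
def bitVal (f : ℕ → Bool) : ℕ → ℕ
  | 0 => 0
  | n + 1 => 2 * bitVal f n + (f n).toNat

theorem Build.exists_bitVal {vs : List (List (Fin 2))} {s : ℕ} (h : Build vs s) {f : ℕ → Bool}
    (hf : f 0 = true) (n : ℕ) :
    ∃ vs' s', Build vs' s' ∧ s' ≤ s + 3 * n ∧ vs ⊆ vs' ∧
      ∀ i, 1 ≤ i → i ≤ n → aBlock (bitVal f i) ∈ vs' := by
  induction n with
  | zero => exact ⟨vs, s, h, by omega, by simp, by omega⟩
  | succ n ih =>
    obtain ⟨vs', s', hb, hs, hv, hn⟩ := ih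
    obtain ⟨s'', hs', hb'⟩ : ∃ s'' ≤ s' + 3, Build (aBlock (bitVal f (n + 1)) :: vs') s'' := by
      rcases Nat.eq_zero_or_pos n with rfl | h0
      · simpa [bitVal, hf] using hb.one
      · exact hb.double (hn n h0 le_rfl) _
    refine ⟨_, s'', hb', by omega, fun x hx => List.mem_cons_of_mem _ (hv hx), fun i h1 h2 => ?_⟩
    rcases Nat.lt_or_ge i (n + 1) with h3 | h3
    · exact List.mem_cons_of_mem _ (hn i h1 (by omega))
    · obtain rfl : i = n + 1 := by omega
      simp

/-- The word `a^{m₁} b ⋯ a^{mₙ} b a^m`, where `ms = [m₁, …, mₙ]`. -/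
def blockWord (ms : List ℕ) (m : ℕ) : List (Fin 2) :=
  (ms.flatMap fun m => aBlock m ++ [1]) ++ aBlock m

theorem Build.smallestSize_blockWord_le {vs : List (List (Fin 2))} {s : ℕ} (h : Build vs s)
    {ms : List ℕ} {m : ℕ} (hms : ∀ i ∈ ms, aBlock i ∈ vs) (hm : aBlock m ∈ vs) :
    smallestSize (blockWord ms m) ≤ s + 2 * ms.length + 1 := by
  have key := h.step ((ms.flatMap fun i => [aBlock i, [1]]) ++ [aBlock m]) (by simp) (by
    intro p hp
    simp only [List.mem_append, List.mem_flatMap, List.mem_cons, List.not_mem_nil, or_false] at hp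
    rcases hp with ⟨i, hi, rfl | rfl⟩ | rfl
    · exact Or.inl (hms i hi)
    · exact Or.inr ⟨1, rfl⟩
    · exact Or.inl hm)
  have h1 : ((ms.flatMap fun i => [aBlock i, [1]]) ++ [aBlock m]).flatten = blockWord ms m := by
    rw [blockWord, List.flatten_append]
    congr 1
    · clear key hms
      induction ms with
      | nil => rfl
      | cons i ms ih => simp [ih]
    · simp
  have h2 : ((ms.flatMap fun i => [aBlock i, [1]]) ++ [aBlock m]).length = 2 * ms.length + 1 := by
    simp [List.length_flatMap]
    omega
  rw [h1, h2] at key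
  exact (key.smallestSize_le (by simp)).trans (by omega)

/-! ### The first rounds of RePair on words with long unary blocks -/

/-- The symbol that derives `a^(2^j)` in `phaseGrammar`. -/
def powSym (j : ℕ) : Symbol (Fin 2) ℕ :=
  if j = 0 then Symbol.terminal 0 else Symbol.nonterminal j

/-- The separator `b`. -/
def sepSym : Symbol (Fin 2) ℕ := Symbol.terminal 1

/-- The binary digits `1` of `m` at the positions below `j`, from the most significant one to the
least significant one. -/
def lowPart : ℕ → ℕ → List (Symbol (Fin 2) ℕ)
  | 0, _ => []
  | j + 1, m => (if m.testBit j then [powSym j] else []) ++ lowPart j m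

/-- The block `a^m` after `j` rounds. -/
def phaseBlock (j m : ℕ) : List (Symbol (Fin 2) ℕ) :=
  List.replicate (m / 2 ^ j) (powSym j) ++ lowPart j m

/-- The word `blockWord ms m` after `j` rounds. -/
def phaseWord (j : ℕ) (ms : List ℕ) (m : ℕ) : List (Symbol (Fin 2) ℕ) :=
  (ms.flatMap fun m => phaseBlock j m ++ [sepSym]) ++ phaseBlock j m

/-- The grammar after `j` rounds on `blockWord ms m`, provided that the blocks are long. -/
def phaseGrammar (j : ℕ) (ms : List ℕ) (m : ℕ) : Grammar (Fin 2) :=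
  ⟨phaseWord j ms m :: (List.range j).map fun i => [powSym i, powSym i], 0⟩

theorem powSym_injective : Function.Injective powSym := by
  intro i j h
  unfold powSym at h
  split_ifs at h with h1 h2 h2
  · omega
  · exact Symbol.nonterminal.inj h

theorem powSym_ne_sepSym (j : ℕ) : powSym j ≠ sepSym := by
  unfold powSym sepSym
  split_ifs <;> simp

theorem powSym_succ (j : ℕ) : powSym (j + 1) = Symbol.nonterminal (j + 1) := rfl

theorem mem_lowPart {j m : ℕ} {y : Symbol (Fin 2) ℕ} :
    y ∈ lowPart j m ↔ ∃ i < j, m.testBit i = true ∧ y = powSym i := by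
  induction j with
  | zero => simp [lowPart]
  | succ j ih =>
    rw [lowPart, List.mem_append, ih]
    constructor
    · rintro (h | ⟨i, hi, h⟩)
      · split_ifs at h with hb
        · exact ⟨j, by omega, hb, by simpa using h⟩
        · simp at h
      · exact ⟨i, by omega, h⟩
    · rintro ⟨i, hi, hb, rfl⟩
      rcases Nat.lt_succ_iff_lt_or_eq.1 hi with hi | rfl
      · exact Or.inr ⟨i, hi, hb, rfl⟩
      · exact Or.inl (by simp [hb])

theorem powSym_notMem_lowPart {i j : ℕ} (h : j ≤ i) (m : ℕ) : powSym i ∉ lowPart j m := by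
  rw [mem_lowPart]
  rintro ⟨l, hl, -, h'⟩
  have := powSym_injective h'
  omega

theorem sepSym_notMem_lowPart (j m : ℕ) : sepSym ∉ lowPart j m := by
  rw [mem_lowPart]
  rintro ⟨l, hl, -, h'⟩
  exact powSym_ne_sepSym l h'.symm

theorem sepSym_notMem_phaseBlock (j m : ℕ) : sepSym ∉ phaseBlock j m := by
  rw [phaseBlock, List.mem_append, not_or]
  exact ⟨fun h => powSym_ne_sepSym j (List.eq_of_mem_replicate h).symm, sepSym_notMem_lowPart j m⟩

theorem nodup_lowPart (j m : ℕ) : (lowPart j m).Nodup := by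
  induction j with
  | zero => simp [lowPart]
  | succ j ih =>
    rw [lowPart]
    split_ifs
    · exact List.nodup_cons.2 ⟨powSym_notMem_lowPart le_rfl m, ih⟩
    · exact ih

theorem count_phaseBlock_le {j m : ℕ} {y : Symbol (Fin 2) ℕ} (hy : y ≠ powSym j) :
    (phaseBlock j m).count y ≤ 1 := by
  rw [phaseBlock, List.count_append, List.count_replicate, if_neg (by simpa using hy.symm),
    Nat.zero_add]
  exact List.nodup_iff_count_le_one.1 (nodup_lowPart j m) y

theorem count_phaseBlock_self (j m : ℕ) : (phaseBlock j m).count (powSym j) = m / 2 ^ j := by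
  rw [phaseBlock, List.count_append, List.count_replicate_self,
    List.count_eq_zero_of_not_mem (powSym_notMem_lowPart le_rfl m), Nat.add_zero]

theorem count_phaseWord_le {j m : ℕ} (ms : List ℕ) {y : Symbol (Fin 2) ℕ} (hy : y ≠ powSym j) :
    (phaseWord j ms m).count y ≤ ms.length + 1 := by
  induction ms with
  | nil => simpa [phaseWord] using count_phaseBlock_le hy
  | cons n ms ih =>
    have h1 : (phaseBlock j n ++ [sepSym]).count y ≤ 1 := by
      by_cases h : y = sepSym
      · rw [h, List.count_append, List.count_eq_zero_of_not_mem (sepSym_notMem_phaseBlock j n)]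
        simp
      · rw [List.count_append, List.count_cons_of_ne (Ne.symm h)]
        simpa using count_phaseBlock_le hy
    have h2 : phaseWord j (n :: ms) m = (phaseBlock j n ++ [sepSym]) ++ phaseWord j ms m := by
      simp [phaseWord]
    rw [h2, List.count_append, List.length_cons]
    omega

theorem count_phaseWord_self (j : ℕ) (ms : List ℕ) (m : ℕ) :
    (phaseWord j ms m).count (powSym j) = (ms.map (· / 2 ^ j)).sum + m / 2 ^ j := by
  induction ms with
  | nil => simpa [phaseWord] using count_phaseBlock_self j m
  | cons n ms ih =>
    have h2 : phaseWord j (n :: ms) m = (phaseBlock j n ++ [sepSym]) ++ phaseWord j ms m := by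
      simp [phaseWord]
    rw [h2, List.count_append, ih, List.count_append, count_phaseBlock_self,
      List.count_cons_of_ne (powSym_ne_sepSym j).symm]
    simp
    omega

theorem replaceOcc_append_cons_of_ne {β : Type} [DecidableEq β] {s b : β} (hb : b ≠ s) (X : β)
    (u t : List β) :
    replaceOcc [s, s] X (u ++ b :: t) = replaceOcc [s, s] X u ++ b :: replaceOcc [s, s] X t := by
  induction u using occ_induction (γ := [s, s]) (by simp) with
  | nil =>
    rw [replaceOcc_nil, List.nil_append, List.nil_append, replaceOcc_cons_of_not]
    rintro ⟨z, hz⟩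
    simp at hz
    exact hb hz.1.symm
  | occ u ih =>
    rw [List.append_assoc, replaceOcc_append_self (by simp), replaceOcc_append_self (by simp), ih,
      List.cons_append]
  | skip x u h ih =>
    rw [replaceOcc_cons_of_not X h, List.cons_append, replaceOcc_cons_of_not, ih, List.cons_append]
    rintro ⟨z, hz⟩
    cases u with
    | nil =>
      simp at hz
      exact hb hz.2.1.symm
    | cons y u =>
      simp at hz
      exact h ⟨u, by simp [← hz.1, ← hz.2.1]⟩

theorem replaceOcc_phaseBlock (j m : ℕ) :
    replaceOcc [powSym j, powSym j] (powSym (j + 1)) (phaseBlock j m) = phaseBlock (j + 1) m := by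
  rw [phaseBlock, replaceOcc_replicate_append _ _ _ (powSym_notMem_lowPart le_rfl m), phaseBlock,
    lowPart, Nat.div_div_eq_div_mul, ← pow_succ]
  congr 2
  rw [Nat.testBit_eq_decide_div_mod_eq]
  rcases Nat.mod_two_eq_zero_or_one (m / 2 ^ j) with h | h <;> simp [h]

theorem replaceOcc_phaseWord (j : ℕ) (ms : List ℕ) (m : ℕ) :
    replaceOcc [powSym j, powSym j] (powSym (j + 1)) (phaseWord j ms m) =
      phaseWord (j + 1) ms m := by
  induction ms with
  | nil => simpa [phaseWord] using replaceOcc_phaseBlock j m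
  | cons n ms ih =>
    have h2 : ∀ j, phaseWord j (n :: ms) m = phaseBlock j n ++ sepSym :: phaseWord j ms m := by
      simp [phaseWord]
    rw [h2, h2, replaceOcc_append_cons_of_ne (powSym_ne_sepSym j).symm, ih, replaceOcc_phaseBlock]

theorem countOcc_pair_le {β : Type} [DecidableEq β] {δ : List β} (h : 2 ≤ δ.length) (x : β) :
    countOcc δ [x, x] ≤ if δ = [x, x] then 1 else 0 := by
  have h0 : δ ≠ [] := by rintro rfl; simp at h
  have h1 : countOcc δ [x, x] ≤ 1 := by
    have := length_replaceOcc h0 x [x, x]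
    have h2 : countOcc δ [x, x] * 2 ≤ countOcc δ [x, x] * δ.length := Nat.mul_le_mul_left _ h
    have h3 := List.length_pos_iff.2 (replaceOcc_ne_nil h0 x (u := [x, x]) (by simp))
    simp only [List.length_cons, List.length_nil] at this
    omega
  split_ifs with hd
  · exact h1
  · by_contra! hc
    exact hd ((infix_of_countOcc_pos h0 hc).eq_of_length_le (by simpa using h))

theorem sum_countOcc_pairs_eq_zero {δ : List (Symbol (Fin 2) ℕ)} (h : 2 ≤ δ.length) {j : ℕ}
    (hj : ∀ i < j, δ ≠ [powSym i, powSym i]) :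
    (((List.range j).map fun i => [powSym i, powSym i]).map (countOcc δ)).sum = 0 := by
  refine List.sum_eq_zero fun x hx => ?_
  simp only [List.map_map, List.mem_map, List.mem_range, Function.comp_apply] at hx
  obtain ⟨i, hi, rfl⟩ := hx
  simpa [hj i hi] using countOcc_pair_le h (powSym i)

theorem sum_countOcc_pairs_le_one {δ : List (Symbol (Fin 2) ℕ)} (h : 2 ≤ δ.length) (j : ℕ) :
    (((List.range j).map fun i => [powSym i, powSym i]).map (countOcc δ)).sum ≤ 1 := by
  induction j with
  | zero => simp
  | succ j ih =>
    have h1 := countOcc_pair_le h (powSym j)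
    simp only [List.range_succ, List.map_append, List.sum_append, List.map_cons, List.map_nil,
      List.sum_cons, List.sum_nil, Nat.add_zero]
    split_ifs at h1 with hd
    · rw [sum_countOcc_pairs_eq_zero h]
      · omega
      · rintro i hi rfl
        have := powSym_injective (List.cons.inj hd).1
        omega
    · omega

theorem replace_phaseGrammar (j : ℕ) (ms : List ℕ) (m : ℕ) :
    (phaseGrammar j ms m).replace [powSym j, powSym j] = phaseGrammar (j + 1) ms m := by
  have h : ∀ X, ((List.range j).map fun i => [powSym i, powSym i]).map
      (replaceOcc [powSym j, powSym j] X) = (List.range j).map fun i => [powSym i, powSym i] := by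
    intro X
    rw [List.map_map]
    refine List.map_congr_left fun i hi => replaceOcc_eq_self (by simp) X ?_
    have h1 : ([powSym j, powSym j] : List (Symbol (Fin 2) ℕ)) ≠ [powSym i, powSym i] := by
      intro h
      have := powSym_injective (List.cons.inj h).1
      simp at hi
      omega
    simpa [h1] using countOcc_pair_le (δ := [powSym j, powSym j]) (by simp) (powSym i)
  have hlen : (phaseGrammar j ms m).rules.length = j + 1 := by simp [phaseGrammar]
  rw [Grammar.replace, hlen]
  simp only [phaseGrammar, List.map_cons, h, ← powSym_succ, replaceOcc_phaseWord,
    List.range_succ, List.map_append, List.map_nil, List.cons_append]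

theorem countOcc_phaseWord (j : ℕ) (ms : List ℕ) (m : ℕ) :
    countOcc [powSym j, powSym j] (phaseWord j ms m) =
      (ms.map (· / 2 ^ (j + 1))).sum + m / 2 ^ (j + 1) := by
  have hb : ∀ n, powSym (j + 1) ∉ phaseBlock j n := by
    intro n
    rw [phaseBlock, List.mem_append, not_or]
    refine ⟨fun h => ?_, powSym_notMem_lowPart (by omega) n⟩
    have := powSym_injective (List.eq_of_mem_replicate h)
    omega
  have hnew : powSym (j + 1) ∉ phaseWord j ms m := by
    simp only [phaseWord, List.mem_append, List.mem_flatMap, List.mem_singleton, not_or,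
      not_exists, not_and]
    exact ⟨fun n _ => ⟨hb n, powSym_ne_sepSym _⟩, hb m⟩
  rw [← count_replaceOcc (by simp) hnew, replaceOcc_phaseWord, count_phaseWord_self]

theorem freq_phaseGrammar (j : ℕ) (ms : List ℕ) (m : ℕ) (δ : List (Symbol (Fin 2) ℕ)) :
    (phaseGrammar j ms m).freq δ = countOcc δ (phaseWord j ms m) +
      (((List.range j).map fun i => [powSym i, powSym i]).map (countOcc δ)).sum := by
  simp [Grammar.freq, phaseGrammar]

/-- While the blocks are long, `powSym j, powSym j` is the unique most frequent word. Let `F` be its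
number of occurrences in the start production and `N` the number of blocks. A word with another
letter occurs at most `N + 1` times, and a longer power of `powSym j` at most `(2 * F + N) / 3 + 1`
times. Both numbers are less than `F` if `N + 3 < F`. -/
theorem freq_phaseGrammar_lt {j : ℕ} {ms : List ℕ} {m : ℕ}
    (hm : ms.length + 4 < m / 2 ^ (j + 1)) {δ : List (Symbol (Fin 2) ℕ)} (h : 2 ≤ δ.length)
    (hδ : δ ≠ [powSym j, powSym j]) :
    (phaseGrammar j ms m).freq δ < (phaseGrammar j ms m).freq [powSym j, powSym j] := by
  have h0 : δ ≠ [] := by rintro rfl; simp at h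
  have h1 := sum_countOcc_pairs_le_one h j
  have h7 := sum_countOcc_pairs_le_one (δ := [powSym j, powSym j]) (by simp) j
  rw [freq_phaseGrammar, freq_phaseGrammar, countOcc_phaseWord]
  by_cases hy : ∃ y ∈ δ, y ≠ powSym j
  · obtain ⟨y, hy, hne⟩ := hy
    have h2 := count_mul_countOcc_le h0 y (phaseWord j ms m)
    have h3 := count_phaseWord_le (m := m) ms hne
    have h4 : countOcc δ (phaseWord j ms m) * 1 ≤ countOcc δ (phaseWord j ms m) * δ.count y :=
      Nat.mul_le_mul_left _ (List.count_pos_iff.2 hy)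
    omega
  · push Not at hy
    have hrep := List.eq_replicate_of_mem hy
    have hl : 3 ≤ δ.length := by
      by_contra hc
      have : δ.length = 2 := by omega
      rw [this] at hrep
      exact hδ hrep
    have h2 := count_mul_countOcc_le h0 (powSym j) (phaseWord j ms m)
    rw [count_phaseWord_self, hrep, List.count_replicate_self, ← hrep] at h2
    have h3 : countOcc δ (phaseWord j ms m) * 3 ≤ countOcc δ (phaseWord j ms m) * δ.length :=
      Nat.mul_le_mul_left _ hl
    have h4 : ∀ n : ℕ, n / 2 ^ j ≤ 2 * (n / 2 ^ (j + 1)) + 1 := by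
      intro n
      rw [pow_succ, ← Nat.div_div_eq_div_mul]
      omega
    have h5 : (ms.map (· / 2 ^ j)).sum ≤ 2 * (ms.map (· / 2 ^ (j + 1))).sum + ms.length := by
      clear * - h4
      induction ms with
      | nil => simp
      | cons n ms ih =>
        have := h4 n
        simp only [List.map_cons, List.sum_cons, List.length_cons]
        omega
    have h6 := h4 m
    omega

/-- Every output on a word with long blocks is reached through `phaseGrammar`. -/
theorem Variant.Output.reach_phaseGrammar {v : Variant} {ms : List ℕ} {m k : ℕ}
    (hm : ms.length + 4 < m / 2 ^ k) {G : Grammar (Fin 2)} (h : v.Output (blockWord ms m) G) :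
    Relation.ReflTransGen v.Step (phaseGrammar k ms m) G := by
  have key : ∀ j ≤ k, Relation.ReflTransGen v.Step (phaseGrammar j ms m) G := by
    intro j
    induction j with
    | zero =>
      intro _
      have hb : ∀ n, (aBlock n).map Symbol.terminal = phaseBlock 0 n := by
        intro n
        simp [aBlock, phaseBlock, lowPart, powSym]
      have : phaseGrammar 0 ms m = Grammar.trivial (blockWord ms m) := by
        simp [phaseGrammar, Grammar.trivial, phaseWord, blockWord, hb, List.map_flatMap, sepSym]
      rw [this]
      exact h.1
    | succ j ih =>
      intro hj
      have hm' : ms.length + 4 < m / 2 ^ (j + 1) :=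
        hm.trans_le (Nat.div_le_div_left (Nat.pow_le_pow_right (by omega) hj) (by positivity))
      have hlt := fun δ => freq_phaseGrammar_lt (δ := δ) hm'
      have h2 : 2 ≤ (phaseGrammar j ms m).freq [powSym j, powSym j] := by
        rw [freq_phaseGrammar, countOcc_phaseWord]
        omega
      have hcand : v.Candidate (phaseGrammar j ms m) [powSym j, powSym j] := by
        cases v with
        | digram => exact ⟨rfl, h2⟩
        | maximalString =>
          refine ⟨le_rfl, h2, fun δ hδ => hlt δ hδ.le ?_⟩
          rintro rfl
          exact lt_irrefl _ hδ
      rcases (ih (by omega)).cases_head with heq | ⟨H, ⟨γ, hγ, hmax, rfl⟩, hH⟩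
      · exact absurd hcand (heq ▸ h.2 _)
      · have hγ' : γ = [powSym j, powSym j] := by
          by_contra hne
          exact absurd (hmax _ hcand) (not_le.2 (hlt γ hγ.abbreviable.1 hne))
        rwa [hγ', replace_phaseGrammar] at hH
  exact key k le_rfl

/-! ### The remaining rounds: a lower bound by factors that occur only once -/

section Covering

variable {α : Type}

/-- An invariant of the rounds that follow a grammar with start production `T` and further
productions `D`. The map `φ` expands the nonterminals introduced since then and fixes all other
symbols that occur. What a new nonterminal expands to occurs twice in `T`. -/
def Covering (T : List (Symbol α ℕ)) (D : List (List (Symbol α ℕ))) (H : Grammar α) : Prop :=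
  H.Closed ∧ ∃ (S : List (Symbol α ℕ)) (E : List (List (Symbol α ℕ)))
    (φ : Symbol α ℕ → List (Symbol α ℕ)),
    H.rules = S :: (D ++ E) ∧ S.flatMap φ = T ∧
    (∀ Y, φ Y = [Y] ∨ HasFactors [φ Y, φ Y] T) ∧
    (∀ r ∈ E, HasFactors [r.flatMap φ, r.flatMap φ] T) ∧
    ∀ r ∈ D, ∀ Y ∈ r, φ Y = [Y]

theorem flatMap_eq_self {β : Type} {φ : β → List β} {u : List β} (h : ∀ y ∈ u, φ y = [y]) :
    u.flatMap φ = u := by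
  induction u with
  | nil => rfl
  | cons y u ih =>
    rw [List.flatMap_cons, h y (by simp), ih fun z hz => h z (by simp [hz])]
    rfl

theorem flatMap_infix {β γ : Type} (φ : β → List γ) {u v : List β} (h : u <:+: v) :
    u.flatMap φ <:+: v.flatMap φ := by
  obtain ⟨x, y, rfl⟩ := h
  exact ⟨x.flatMap φ, y.flatMap φ, by simp⟩

/-- A nonterminal cannot expand to a word containing a factor of `T` that does not repeat. Hence
each of the disjoint factors `us` is cut by the start production. -/
theorem Covering.length_le_size {T : List (Symbol α ℕ)} {D : List (List (Symbol α ℕ))}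
    {H : Grammar α} (hH : Covering T D H) {us : List (List (Symbol α ℕ))}
    (hus : HasFactors us T)
    (h : ∀ u ∈ us, 2 ≤ u.length ∧ ¬ HasFactors [u, u] T) : us.length ≤ H.size := by
  obtain ⟨-, S, E, φ, hr, hS, hφ, -, -⟩ := hH
  have h1 : us.length ≤ (S.map φ).length := by
    refine HasFactors.length_le (by rwa [← List.flatMap_def, hS]) ?_ ?_
    · rintro u hu rfl
      exact absurd (h _ hu).1 (by simp)
    · intro u hu e he hi
      obtain ⟨Y, -, rfl⟩ := List.mem_map.1 he
      rcases hφ Y with hY | hY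
      · rw [hY] at hi
        exact absurd (hi.length_le.trans_lt Nat.one_lt_two) (not_lt.2 (h u hu).1)
      · exact (h u hu).2 (hY.two_mono hi)
  rw [List.length_map] at h1
  simp [Grammar.size, hr]
  omega

variable [DecidableEq α]

theorem sum_map_countOcc_pos {γ : List (Symbol α ℕ)} (hγ : γ ≠ []) {E : List (List (Symbol α ℕ))}
    (h : 0 < (E.map (countOcc γ)).sum) : ∃ r ∈ E, γ <:+: r := by
  by_contra! hn
  have : (E.map (countOcc γ)).sum = 0 := by
    refine List.sum_eq_zero fun x hx => ?_
    obtain ⟨r, hr, rfl⟩ := List.mem_map.1 hx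
    by_contra hc
    exact hn r hr (infix_of_countOcc_pos hγ (Nat.pos_of_ne_zero hc))
  omega

theorem Covering.replace {T : List (Symbol α ℕ)} {D : List (List (Symbol α ℕ))} {H : Grammar α}
    (hH : Covering T D H)
    (hD : ∀ γ : List (Symbol α ℕ), 2 ≤ γ.length → (D.map (countOcc γ)).sum ≤ 1)
    (hDT : ∀ γ : List (Symbol α ℕ), 2 ≤ γ.length → ∀ r ∈ D, γ <:+: r → ¬ γ <:+: T)
    {γ : List (Symbol α ℕ)} (h : H.Abbreviable γ) : Covering T D (H.replace γ) := by
  obtain ⟨hcl, S, E, φ, hr, hS, hφ, hE, hfix⟩ := hH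
  have hγ := h.ne_nil
  have hfreq : 2 ≤ countOcc γ S + ((D.map (countOcc γ)).sum + (E.map (countOcc γ)).sum) := by
    have := h.2
    simpa [Grammar.freq, hr] using this
  have hT : ∀ r, r = S ∨ r ∈ E → γ <:+: r → γ.flatMap φ <:+: T := by
    rintro r (rfl | hrE) hi
    · exact hS ▸ flatMap_infix φ hi
    · exact (flatMap_infix φ hi).trans ((hE r hrE).infix_of_mem (by simp))
  -- `γ` does not occur in `D`: it would have another occurrence, hence occur in `T`
  have hnD : ∀ r ∈ D, ¬ γ <:+: r := by
    intro r hrD hi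
    have he : γ.flatMap φ = γ := flatMap_eq_self fun y hy => hfix r hrD y (hi.subset hy)
    refine hDT γ h.1 r hrD hi ?_
    have h1 := hD γ h.1
    rw [← he]
    rcases Nat.eq_zero_or_pos (countOcc γ S) with h0 | h0
    · obtain ⟨r', hr', hi'⟩ := sum_map_countOcc_pos hγ (E := E) (by omega)
      exact hT r' (Or.inr hr') hi'
    · exact hT S (Or.inl rfl) (infix_of_countOcc_pos hγ h0)
  have hD0 : (D.map (countOcc γ)).sum = 0 := by
    by_contra hc
    obtain ⟨r, hrD, hi⟩ := sum_map_countOcc_pos hγ (Nat.pos_of_ne_zero hc)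
    exact hnD r hrD hi
  have htwo : HasFactors [γ.flatMap φ, γ.flatMap φ] T := by
    rcases Nat.eq_zero_or_pos (E.map (countOcc γ)).sum with h0 | h0
    · have := (hasFactors_two_of_countOcc hγ (u := S) (by omega)).flatMap φ
      simpa [hS] using this
    · obtain ⟨r, hrE, hi⟩ := sum_map_countOcc_pos hγ h0
      exact (hE r hrE).two_mono (flatMap_infix φ hi)
  set X : Symbol α ℕ := Symbol.nonterminal H.rules.length with hX
  have hXn : ∀ r ∈ H.rules, X ∉ r := fun r hr hm => lt_irrefl _ (hcl r hr _ hm)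
  have hXγ : X ∉ γ := fun hm => lt_irrefl _ (h.lt_of_mem hcl hm)
  rw [hr] at hXn
  have hφγ : γ.flatMap (Function.update φ X (γ.flatMap φ)) = γ.flatMap φ :=
    List.flatMap_congr fun y hy => Function.update_of_ne (by rintro rfl; exact hXγ hy) _ _
  refine ⟨hcl.replace h, replaceOcc γ X S, E.map (replaceOcc γ X) ++ [γ],
    Function.update φ X (γ.flatMap φ), ?_, ?_, ?_, ?_, ?_⟩
  · have hDD : D.map (replaceOcc γ X) = D := by
      conv_rhs => rw [← List.map_id D]
      refine List.map_congr_left fun r hrD => replaceOcc_eq_self hγ X ?_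
      by_contra hc
      exact hnD r hrD (infix_of_countOcc_pos hγ (Nat.pos_of_ne_zero hc))
    rw [Grammar.replace, ← hX, hr]
    simp [hDD]
  · rw [flatMap_replaceOcc hγ (hXn S (by simp)), hS]
  · intro Y
    by_cases hY : Y = X
    · subst hY
      exact Or.inr (by simpa using htwo)
    · simpa [Function.update_of_ne hY] using hφ Y
  · intro r hrE
    rcases List.mem_append.1 hrE with hrE | hrE
    · obtain ⟨r, hr', rfl⟩ := List.mem_map.1 hrE
      rw [flatMap_replaceOcc hγ (hXn r (by simp [hr']))]
      exact hE r hr'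
    · obtain rfl := List.mem_singleton.1 hrE
      rwa [hφγ]
  · intro r hrD Y hY
    rw [Function.update_of_ne, hfix r hrD Y hY]
    rintro rfl
    exact hXn r (by simp [hrD]) hY

theorem Variant.covering_of_reach {v : Variant} {T : List (Symbol α ℕ)}
    {D : List (List (Symbol α ℕ))} {G H : Grammar α} (hG : Covering T D G)
    (hD : ∀ γ : List (Symbol α ℕ), 2 ≤ γ.length → (D.map (countOcc γ)).sum ≤ 1)
    (hDT : ∀ γ : List (Symbol α ℕ), 2 ≤ γ.length → ∀ r ∈ D, γ <:+: r → ¬ γ <:+: T)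
    (h : Relation.ReflTransGen v.Step G H) : Covering T D H := by
  induction h with
  | refl => exact hG
  | tail _ h ih =>
    obtain ⟨γ, hγ, rfl⟩ := h.exists_abbreviable
    exact ih.replace hD hDT hγ

end Covering

theorem infix_phaseWord {k m : ℕ} {ms : List ℕ} {u : List (Symbol (Fin 2) ℕ)} (hu : sepSym ∉ u)
    (h : u <:+: phaseWord k ms m) : ∃ n ∈ ms ++ [m], u <:+: phaseBlock k n := by
  induction ms with
  | nil => exact ⟨m, by simp, by simpa [phaseWord] using h⟩
  | cons n ms ih =>
    have h2 : phaseWord k (n :: ms) m = phaseBlock k n ++ sepSym :: phaseWord k ms m := by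
      simp [phaseWord]
    rw [h2] at h
    rcases infix_append_cons hu h with h | h
    · exact ⟨n, by simp, h⟩
    · obtain ⟨n', hn', h'⟩ := ih h
      exact ⟨n', by simp_all, h'⟩

/-- A factor without separators repeats in `phaseWord` only if it repeats within a block or occurs
in two blocks. -/
theorem not_hasFactors_two_phaseWord {k m : ℕ} {ms : List ℕ} {u : List (Symbol (Fin 2) ℕ)}
    (hu : sepSym ∉ u) (h1 : ∀ n, ¬ HasFactors [u, u] (phaseBlock k n))
    (h2 : (ms ++ [m]).Pairwise fun n n' => ¬ (u <:+: phaseBlock k n ∧ u <:+: phaseBlock k n')) :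
    ¬ HasFactors [u, u] (phaseWord k ms m) := by
  induction ms with
  | nil => simpa [phaseWord] using h1 m
  | cons n ms ih =>
    have h3 : phaseWord k (n :: ms) m = phaseBlock k n ++ sepSym :: phaseWord k ms m := by
      simp [phaseWord]
    rw [List.cons_append, List.pairwise_cons] at h2
    rw [h3]
    intro h
    rcases hasFactors_two_append_cons hu h with h | h | ⟨h, h'⟩
    · exact h1 n h
    · exact ih h2.2 h
    · obtain ⟨n', hn', h''⟩ := infix_phaseWord hu h'
      exact h2.1 n' hn' ⟨h, h''⟩

theorem two_mul_count_le_of_hasFactors {β : Type} [DecidableEq β] {u x : List β}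
    (h : HasFactors [u, u] x) (y : β) : 2 * u.count y ≤ x.count y := by
  obtain ⟨z, t, rfl, z', t', rfl, -⟩ := h
  simp only [List.count_append]
  omega

theorem not_hasFactors_two_phaseBlock {k j : ℕ} (hj : j < k) {u : List (Symbol (Fin 2) ℕ)}
    (hu : powSym j ∈ u) (n : ℕ) : ¬ HasFactors [u, u] (phaseBlock k n) := by
  intro h
  have h1 := two_mul_count_le_of_hasFactors h (powSym j)
  have h2 := count_phaseBlock_le (m := n) (fun e => hj.ne (powSym_injective e))
  have h3 := List.count_pos_iff.2 hu
  omega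

theorem covering_phaseGrammar (k : ℕ) (ms : List ℕ) (m : ℕ) :
    Covering (phaseWord k ms m) ((List.range k).map fun i => [powSym i, powSym i])
      (phaseGrammar k ms m) := by
  refine ⟨?_, phaseWord k ms m, [], fun Y => [Y], by simp [phaseGrammar], by simp, by simp,
    by simp, by simp⟩
  have hp : ∀ {i j}, Symbol.nonterminal j = powSym i → j = i := by
    intro i j h
    unfold powSym at h
    split_ifs at h
    exact Symbol.nonterminal.inj h
  have hb : ∀ {j n}, Symbol.nonterminal j ∈ phaseBlock k n → j < k + 1 := by
    intro j n h
    rcases List.mem_append.1 h with h | h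
    · have := hp (List.eq_of_mem_replicate h)
      omega
    · obtain ⟨i, hi, -, h⟩ := mem_lowPart.1 h
      have := hp h
      omega
  intro r hr j hj
  have hlen : (phaseGrammar k ms m).rules.length = k + 1 := by simp [phaseGrammar]
  rw [hlen]
  simp only [phaseGrammar, List.mem_cons, List.mem_map, List.mem_range] at hr
  rcases hr with rfl | ⟨i, hi, rfl⟩
  · simp only [phaseWord, List.mem_append, List.mem_flatMap, List.mem_singleton] at hj
    rcases hj with ⟨n, -, hj | hj⟩ | hj
    · exact hb hj
    · simp [sepSym] at hj
    · exact hb hj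
  · have : j = i := hp (by simpa using hj)
    omega

/-- The number of disjoint factors that do not repeat is a lower bound for every output. -/
theorem Variant.Output.length_le_size {v : Variant} {ms : List ℕ} {m k : ℕ}
    (hm : ms.length + 4 < m / 2 ^ k) {G : Grammar (Fin 2)} (h : v.Output (blockWord ms m) G)
    {us : List (List (Symbol (Fin 2) ℕ))} (hus : HasFactors us (phaseWord k ms m))
    (h' : ∀ u ∈ us, 2 ≤ u.length ∧ ¬ HasFactors [u, u] (phaseWord k ms m)) :
    us.length ≤ G.size := by
  refine (v.covering_of_reach (covering_phaseGrammar k ms m)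
    (fun γ hγ => sum_countOcc_pairs_le_one hγ k) ?_ (h.reach_phaseGrammar hm)).length_le_size
    hus h'
  intro γ hγ r hr hi hT
  obtain ⟨i, hi', rfl⟩ := List.mem_map.1 hr
  obtain rfl := hi.eq_of_length_le (by simpa using hγ)
  obtain ⟨n, -, hn⟩ := infix_phaseWord (by simpa using (powSym_ne_sepSym i).symm) hT
  have h1 := hn.count_le (powSym i)
  have h2 := count_phaseBlock_le (m := n) (fun e => (List.mem_range.1 hi').ne (powSym_injective e))
  simp at h1
  omega

/-! ### Windows of binary digits -/

/-- The digits `1` of `m` at the positions `a, …, a + l - 1`, from the most significant one to the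
least significant one. -/
def digitWord (m a : ℕ) : ℕ → List (Symbol (Fin 2) ℕ)
  | 0 => []
  | l + 1 => (if m.testBit (a + l) then [powSym (a + l)] else []) ++ digitWord m a l

theorem mem_digitWord {m a l : ℕ} {y : Symbol (Fin 2) ℕ} :
    y ∈ digitWord m a l ↔ ∃ i, a ≤ i ∧ i < a + l ∧ m.testBit i = true ∧ y = powSym i := by
  induction l with
  | zero =>
    simp only [digitWord, List.not_mem_nil, false_iff, not_exists]
    omega
  | succ l ih =>
    rw [digitWord, List.mem_append, ih]
    constructor
    · rintro (h | ⟨i, h1, h2, h⟩)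
      · split_ifs at h with hb
        · exact ⟨a + l, by omega, by omega, hb, by simpa using h⟩
        · simp at h
      · exact ⟨i, h1, by omega, h⟩
    · rintro ⟨i, h1, h2, hb, rfl⟩
      rcases Nat.lt_or_ge i (a + l) with hi | hi
      · exact Or.inr ⟨i, h1, hi, hb, rfl⟩
      · obtain rfl : i = a + l := by omega
        exact Or.inl (by simp [hb])

theorem lowPart_add (m a l : ℕ) : lowPart (a + l) m = digitWord m a l ++ lowPart a m := by
  induction l with
  | zero => rfl
  | succ l ih => rw [← Nat.add_assoc, lowPart, ih, digitWord, List.append_assoc]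

theorem lowPart_suffix_phaseBlock {a k : ℕ} (h : a ≤ k) (m : ℕ) :
    lowPart a m <:+ phaseBlock k m := by
  obtain ⟨l, rfl⟩ := Nat.exists_eq_add_of_le h
  rw [phaseBlock, lowPart_add]
  exact ⟨_, by rw [List.append_assoc]⟩

/-- The windows of length `L` selected by `p`, as disjoint factors of a block. -/
theorem hasFactors_digitWords (m k L C : ℕ) (hC : C * L ≤ k) (p : ℕ → Bool) :
    HasFactors (((List.range C).reverse.filter p).map fun c => digitWord m (c * L) L)
      (phaseBlock k m) := by
  obtain ⟨z, hz⟩ := lowPart_suffix_phaseBlock hC m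
  rw [← hz]
  refine HasFactors.prepend ?_ z
  clear hz hC
  induction C with
  | zero => simp [HasFactors]
  | succ C ih =>
    rw [List.range_succ, List.reverse_append, List.reverse_singleton, List.singleton_append,
      Nat.succ_mul, lowPart_add]
    by_cases hp : p C = true
    · rw [List.filter_cons_of_pos hp, List.map_cons]
      exact (hasFactors_self _).append ih
    · rw [List.filter_cons_of_neg hp]
      exact ih.prepend _

theorem pairwise_phaseBlock (k m : ℕ) :
    (phaseBlock k m).Pairwise fun s t => ∀ i j, s = powSym i → t = powSym j → j ≤ i := by
  have key : ∀ a, (lowPart a m).Pairwise fun s t => ∀ i j, s = powSym i → t = powSym j → j ≤ i := by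
    intro a
    induction a with
    | zero => simp [lowPart]
    | succ a ih =>
      rw [lowPart]
      split_ifs
      · refine List.pairwise_cons.2 ⟨fun t ht i j hi hj => ?_, ih⟩
        obtain ⟨l, hl, -, rfl⟩ := mem_lowPart.1 ht
        have h1 := powSym_injective hi
        have h2 := powSym_injective hj
        omega
      · exact ih
  rw [phaseBlock, List.pairwise_append]
  refine ⟨List.pairwise_replicate.2 (Or.inr fun i j hi hj => ?_), key k,
    fun s hs t ht i j hi hj => ?_⟩
  · rw [powSym_injective (hi.symm.trans hj)]
  · obtain ⟨l, hl, -, rfl⟩ := mem_lowPart.1 ht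
    have h1 := powSym_injective ((List.eq_of_mem_replicate hs).symm.trans hi)
    have h2 := powSym_injective hj
    omega

/-- If the digit word of a window of `m` occurs in the block of `n`, then the digits of `m` and `n`
agree between any two digits `1` of the window: block letters come in descending order, and each
letter below `k` determines a digit. -/
theorem testBit_eq_of_infix {k m n a l : ℕ} (hk : a + l ≤ k)
    (h : digitWord m a l <:+: phaseBlock k n) {i₁ i₂ : ℕ} (h1 : a ≤ i₁) (h2 : i₂ < a + l)
    (hb1 : m.testBit i₁ = true) (hb2 : m.testBit i₂ = true) {j : ℕ} (hj1 : i₁ ≤ j) (hj2 : j ≤ i₂) :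
    n.testBit j = m.testBit j := by
  obtain ⟨x, y, hxy⟩ := h
  have hpw := pairwise_phaseBlock k n
  have m1 : powSym i₁ ∈ digitWord m a l := mem_digitWord.2 ⟨i₁, h1, by omega, hb1, rfl⟩
  have m2 : powSym i₂ ∈ digitWord m a l := mem_digitWord.2 ⟨i₂, by omega, h2, hb2, rfl⟩
  rw [← hxy] at hpw
  rw [Bool.eq_iff_iff]
  constructor
  · intro hn
    have hm : powSym j ∈ phaseBlock k n :=
      List.mem_append_right _ (mem_lowPart.2 ⟨j, by omega, hn, rfl⟩)
    rw [← hxy, List.mem_append, List.mem_append] at hm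
    rcases hm with (hm | hm) | hm
    · have := (List.pairwise_append.1 (List.pairwise_append.1 hpw).1).2.2 _ hm _ m2 j i₂ rfl rfl
      obtain rfl : j = i₂ := by omega
      exact hb2
    · obtain ⟨i, -, -, hb, hi⟩ := mem_digitWord.1 hm
      rwa [powSym_injective hi]
    · have := (List.pairwise_append.1 hpw).2.2 _ (List.mem_append_right _ m1) _ hm i₁ j rfl rfl
      obtain rfl : j = i₁ := by omega
      exact hb1
  · intro hm
    have hmem : powSym j ∈ phaseBlock k n := by
      rw [← hxy]
      exact List.mem_append_left _ (List.mem_append_right _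
        (mem_digitWord.2 ⟨j, by omega, by omega, hm, rfl⟩))
    rcases List.mem_append.1 hmem with hc | hc
    · have := powSym_injective (List.eq_of_mem_replicate hc)
      omega
    · obtain ⟨i, -, hb, hi⟩ := mem_lowPart.1 hc
      rwa [powSym_injective hi]

theorem testBit_bitVal (f : ℕ → Bool) {n j : ℕ} (h : j < n) :
    (bitVal f n).testBit j = f (n - 1 - j) := by
  induction n generalizing j with
  | zero => omega
  | succ n ih =>
    cases j with
    | zero =>
      rw [bitVal, Nat.testBit_zero]
      cases hf : f n
      all_goals simp [hf]
    | succ j =>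
      rw [bitVal, Nat.testBit_succ, show (2 * bitVal f n + (f n).toNat) / 2 = bitVal f n by
        cases f n <;> (simp; try omega), ih (by omega)]
      congr 1
      omega

theorem bitVal_lt (f : ℕ → Bool) (n : ℕ) : bitVal f n < 2 ^ n := by
  induction n with
  | zero => simp [bitVal]
  | succ n ih =>
    have : (f n).toNat ≤ 1 := Bool.toNat_le _
    rw [bitVal, pow_succ]
    omega

theorem le_bitVal {f : ℕ → Bool} (hf : f 0 = true) (n : ℕ) : 2 ^ n ≤ bitVal f (n + 1) := by
  induction n with
  | zero => simp [bitVal, hf]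
  | succ n ih =>
    rw [bitVal, pow_succ]
    omega

/-- The block lengths of `s_k`, where `f` is the sequence of the letters of `w_k`. -/
def blockLen (f : ℕ → Bool) (k i : ℕ) : ℕ := bitVal f (k + (i + 1))

theorem testBit_blockLen (f : ℕ → Bool) {k i j : ℕ} (h : j < k) :
    (blockLen f k i).testBit j = f (k + i - j) := by
  rw [blockLen, testBit_bitVal f (by omega)]
  congr 1

/-- A binary sequence without three consecutive zeros whose windows of length `l` below position
`N` are pairwise distinct. -/
structure HasDistinctWindows (f : ℕ → Bool) (N l : ℕ) : Prop where
  exists_true : ∀ p, ∃ x < 3, f (p + x) = true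
  distinct : ∀ p q, p < q → q + l ≤ N → ∃ x < l, f (p + x) ≠ f (q + x)

section Windows

variable {f : ℕ → Bool} {k l : ℕ}

/-- Every window of length `l + 4` has a digit `1` among its three lowest and its three highest
positions. -/
theorem HasDistinctWindows.exists_digits (hf : HasDistinctWindows f (2 * k) l) (i : ℕ) {a : ℕ}
    (ha : a + (l + 4) ≤ k) :
    ∃ i₁ i₂, a ≤ i₁ ∧ i₁ ≤ a + 2 ∧ a + l + 1 ≤ i₂ ∧ i₂ < a + (l + 4) ∧
      (blockLen f k i).testBit i₁ = true ∧ (blockLen f k i).testBit i₂ = true := by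
  obtain ⟨x, hx, h1⟩ := hf.exists_true (k + i - (a + 2))
  obtain ⟨y, hy, h2⟩ := hf.exists_true (k + i - (a + l + 3))
  refine ⟨a + 2 - x, a + l + 3 - y, by omega, by omega, by omega, by omega, ?_, ?_⟩
  · rw [testBit_blockLen f (by omega), ← h1]
    congr 1
    omega
  · rw [testBit_blockLen f (by omega), ← h2]
    congr 1
    omega

theorem HasDistinctWindows.testBit_eq (hf : HasDistinctWindows f (2 * k) l) {i a n : ℕ}
    (ha : a + (l + 4) ≤ k) (h : digitWord (blockLen f k i) a (l + 4) <:+: phaseBlock k n) {j : ℕ}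
    (hj : a + 2 ≤ j) (hj' : j ≤ a + l + 1) : n.testBit j = (blockLen f k i).testBit j := by
  obtain ⟨i₁, i₂, h1, h2, h3, h4, hb1, hb2⟩ := hf.exists_digits i ha
  exact testBit_eq_of_infix ha h h1 h4 hb1 hb2 (by omega) (by omega)

/-- No word contains the windows at the same position of two different blocks. -/
theorem HasDistinctWindows.eq_of_infix (hf : HasDistinctWindows f (2 * k) l) {i i' a n : ℕ}
    (ha : a + (l + 4) ≤ k) (hi : i < k) (hi' : i' < k)
    (h : digitWord (blockLen f k i) a (l + 4) <:+: phaseBlock k n)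
    (h' : digitWord (blockLen f k i') a (l + 4) <:+: phaseBlock k n) : i = i' := by
  have key : ∀ {i i'}, i < i' → i' < k →
      digitWord (blockLen f k i) a (l + 4) <:+: phaseBlock k n →
      ¬ digitWord (blockLen f k i') a (l + 4) <:+: phaseBlock k n := by
    intro i i' hlt hi' h h'
    obtain ⟨x, hx, hne⟩ := hf.distinct (k + i - (a + l + 1)) (k + i' - (a + l + 1))
      (by omega) (by omega)
    have e1 := hf.testBit_eq ha h (j := a + l + 1 - x) (by omega) (by omega)
    have e2 := hf.testBit_eq ha h' (j := a + l + 1 - x) (by omega) (by omega)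
    rw [e1, testBit_blockLen f (by omega), testBit_blockLen f (by omega)] at e2
    apply hne
    convert e2 using 2 <;> omega
  rcases lt_trichotomy i i' with hlt | rfl | hlt
  · exact absurd h' (key hlt hi' h)
  · rfl
  · exact absurd h (key hlt hi h')

theorem digitWord_infix_phaseBlock {m a l k : ℕ} (h : a + l ≤ k) :
    digitWord m a l <:+: phaseBlock k m := by
  have h1 : digitWord m a l <:+: lowPart (a + l) m := ⟨[], lowPart a m, by rw [lowPart_add]; rfl⟩
  exact h1.trans (lowPart_suffix_phaseBlock h m).isInfix

theorem digitWord_two_le_length {m a l i₁ i₂ : ℕ} (h1 : a ≤ i₁) (h : i₁ < i₂) (h2 : i₂ < a + l)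
    (hb1 : m.testBit i₁ = true) (hb2 : m.testBit i₂ = true) : 2 ≤ (digitWord m a l).length := by
  have h3 : [powSym i₁, powSym i₂] ⊆ digitWord m a l := by
    intro y hy
    simp only [List.mem_cons, List.not_mem_nil, or_false] at hy
    rcases hy with rfl | rfl
    · exact mem_digitWord.2 ⟨i₁, h1, by omega, hb1, rfl⟩
    · exact mem_digitWord.2 ⟨i₂, by omega, h2, hb2, rfl⟩
  have h4 : [powSym i₁, powSym i₂].Nodup := by
    simp [powSym_injective.eq_iff, h.ne]
  exact (h4.subperm h3).length_le

/-- The lower bound for outputs on words like `s_k`, possibly with one further block in front, given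
by `ps`. Each of the `k` blocks has `k / (l + 4)` disjoint windows, and for each position of a
window at most one block shares its window with `ps`. -/
theorem HasDistinctWindows.output_size_ge (hf : HasDistinctWindows f (2 * k) l) (hl : 2 ≤ l)
    (hf0 : f 0 = true) (hk : 5 ≤ k) {ps : List ℕ} (hps : ps.length ≤ 1) {v : Variant}
    {G : Grammar (Fin 2)}
    (hG : v.Output (blockWord (ps ++ (List.range (k - 1)).map (blockLen f k))
      (blockLen f k (k - 1))) G) :
    (k - 1) * (k / (l + 4)) ≤ G.size := by
  classical
  set L := l + 4 with hL
  set C := k / L with hC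
  have hCL : C * L ≤ k := Nat.div_mul_le_self k L
  have hcL : ∀ {c}, c < C → c * L + L ≤ k := fun {c} hc =>
    (Nat.succ_mul c L ▸ Nat.mul_le_mul_right L hc : c * L + L ≤ C * L).trans hCL
  -- the windows shared with the padding
  let bad : ℕ → ℕ → Prop := fun i c =>
    ∃ r ∈ ps, digitWord (blockLen f k i) (c * L) L <:+: phaseBlock k r
  let good : ℕ → ℕ → Bool := fun i c => decide ¬ bad i c
  let us : ℕ → List (List (Symbol (Fin 2) ℕ)) := fun i =>
    ((List.range C).reverse.filter (good i)).map fun c => digitWord (blockLen f k i) (c * L) L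
  have hrange : List.range k = List.range (k - 1) ++ [k - 1] := by
    rw [← List.range_succ, Nat.succ_eq_add_one, Nat.sub_add_cancel (by omega)]
  have hus : HasFactors ((List.range k).flatMap us)
      (phaseWord k (ps ++ (List.range (k - 1)).map (blockLen f k)) (blockLen f k (k - 1))) := by
    rw [hrange, List.flatMap_append, phaseWord, List.flatMap_append, List.append_assoc]
    refine HasFactors.prepend (HasFactors.append ?_ ?_) _
    · generalize List.range (k - 1) = is
      induction is with
      | nil => simp [HasFactors]
      | cons i is ih =>
        rw [List.flatMap_cons, List.map_cons, List.flatMap_cons]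
        exact ((hasFactors_digitWords _ k L C hCL _).of_append_left _).append ih
    · rw [List.flatMap_singleton]
      exact hasFactors_digitWords _ k L C hCL _
  -- the first digit of the longest block is `1`, so that `k` rounds are possible
  have hlast : k + 4 < blockLen f k (k - 1) / 2 ^ k := by
    have h1 : 2 ^ (k - 1) * 2 ^ k ≤ blockLen f k (k - 1) := by
      rw [← pow_add, blockLen, show k + (k - 1 + 1) = (k - 1 + k) + 1 by omega]
      exact le_bitVal hf0 _
    have h2 := (Nat.le_div_iff_mul_le (by positivity)).2 h1
    have h3 : ∀ n, n + 9 < 2 ^ (n + 4) := by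
      intro n
      induction n with
      | zero => norm_num
      | succ n ih => rw [show n + 1 + 4 = (n + 4) + 1 by omega, pow_succ]; omega
    have h4 := h3 (k - 5)
    rw [show k - 5 + 4 = k - 1 by omega] at h4
    omega
  have hsize : ((List.range k).flatMap us).length ≤ G.size := by
    refine hG.length_le_size (k := k) ?_ hus ?_
    · rw [List.length_append, List.length_map, List.length_range]
      omega
    · intro u hu
      obtain ⟨i, hi, hu⟩ := List.mem_flatMap.1 hu
      obtain ⟨c, hc, rfl⟩ := List.mem_map.1 hu
      rw [List.mem_filter, List.mem_reverse, List.mem_range] at hc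
      obtain ⟨hc, hg⟩ := hc
      have hg : ¬ bad i c := by simpa [good] using hg
      rw [List.mem_range] at hi
      obtain ⟨i₁, i₂, h1, h2, h3, h4, hb1, hb2⟩ := hf.exists_digits i (hcL hc)
      refine ⟨digitWord_two_le_length h1 (by omega) h4 hb1 hb2, ?_⟩
      refine not_hasFactors_two_phaseWord ?_ (not_hasFactors_two_phaseBlock (j := i₁) ?_ ?_) ?_
      · rw [mem_digitWord]
        rintro ⟨j, -, -, -, hj⟩
        exact powSym_ne_sepSym j hj.symm
      · have := hcL hc
        omega
      · exact mem_digitWord.2 ⟨i₁, h1, by omega, hb1, rfl⟩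
      · have : ps ++ (List.range (k - 1)).map (blockLen f k) ++ [blockLen f k (k - 1)] =
            ps ++ (List.range k).map (blockLen f k) := by
          rw [hrange]
          simp
        rw [this, List.pairwise_append]
        refine ⟨?_, ?_, ?_⟩
        · exact List.pairwise_of_forall_mem_list fun r hr _ _ h => hg ⟨r, hr, h.1⟩
        · rw [List.pairwise_map]
          refine List.Pairwise.imp_of_mem ?_ (List.nodup_range (n := k))
          intro i' i'' hi' hi'' hne h
          rw [List.mem_range] at hi' hi''
          have e1 := hf.eq_of_infix (hcL hc) hi hi' h.1 (digitWord_infix_phaseBlock (hcL hc))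
          have e2 := hf.eq_of_infix (hcL hc) hi hi'' h.2 (digitWord_infix_phaseBlock (hcL hc))
          exact hne (e1.symm.trans e2)
        · exact fun r hr _ _ h => hg ⟨r, hr, h.1⟩
  have hlen : ((List.range k).flatMap us).length =
      ∑ i ∈ Finset.range k, ((Finset.range C).filter fun c => ¬ bad i c).card := by
    have hcard : ∀ i, (us i).length = ((Finset.range C).filter fun c => ¬ bad i c).card := by
      intro i
      simp only [us, List.length_map, List.filter_reverse, List.length_reverse]
      rfl
    rw [List.length_flatMap, List.map_congr_left fun i _ => hcard i]
    rfl
  have hbad : ∑ i ∈ Finset.range k, ((Finset.range C).filter fun c => bad i c).card ≤ C := by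
    simp only [Finset.card_filter]
    rw [Finset.sum_comm]
    calc ∑ c ∈ Finset.range C, ∑ i ∈ Finset.range k, (if bad i c then 1 else 0)
        ≤ ∑ c ∈ Finset.range C, 1 := by
          refine Finset.sum_le_sum fun c hc => ?_
          rw [← Finset.card_filter, Finset.card_le_one]
          intro i hi i' hi'
          rw [Finset.mem_filter, Finset.mem_range] at hi hi'
          obtain ⟨hi, r, hr, h⟩ := hi
          obtain ⟨hi', r', hr', h'⟩ := hi'
          have : r' = r := by
            match ps, hps, hr, hr' with
            | [p], _, hr, hr' => simp_all
          subst this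
          exact hf.eq_of_infix (hcL (Finset.mem_range.1 hc)) hi hi' h h'
      _ = C := by simp
  have hsum : ∑ i ∈ Finset.range k, ((Finset.range C).filter fun c => bad i c).card +
      ∑ i ∈ Finset.range k, ((Finset.range C).filter fun c => ¬ bad i c).card = k * C := by
    rw [← Finset.sum_add_distrib]
    simp [Finset.card_filter_add_card_filter_not]
  rw [Nat.sub_mul, one_mul]
  omega

end Windows

/-! ### Binary sequences with distinct windows -/

/-- The image of the sequence `b` under the homomorphism `0 ↦ 01`, `1 ↦ 10`. -/
def morphSeq (b : ℕ → Bool) (t : ℕ) : Bool := if t % 2 = 0 then b (t / 2) else !b (t / 2)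

theorem morphSeq_even (b : ℕ → Bool) (t : ℕ) : morphSeq b (2 * t) = b t := by
  simp [morphSeq]

theorem morphSeq_odd (b : ℕ → Bool) (t : ℕ) : morphSeq b (2 * t + 1) = !b t := by
  simp [morphSeq, Nat.add_mod, show (2 * t + 1) / 2 = t by omega]

/-- The homomorphism about doubles the length of repeated factors: shifts by an even number come
from a repetition in `b`, and a shift by an odd number forces `b` to be constant, so that it
repeats with shift `1`. -/
theorem hasDistinctWindows_morphSeq {b : ℕ → Bool} {k l : ℕ}
    (hb : ∀ p q, p < q → q + l ≤ k → ∃ x < l, b (p + x) ≠ b (q + x)) :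
    HasDistinctWindows (morphSeq b) (2 * k) (2 * l + 1) := by
  constructor
  · intro p
    obtain ⟨t, rfl | rfl⟩ : ∃ t, p = 2 * t ∨ p = 2 * t + 1 := ⟨p / 2, by omega⟩
    · cases h : b t
      · exact ⟨1, by omega, by rw [morphSeq_odd, h]; rfl⟩
      · exact ⟨0, by omega, by rw [Nat.add_zero, morphSeq_even, h]⟩
    · cases h : b (t + 1)
      · exact ⟨2, by omega, by
          rw [show 2 * t + 1 + 2 = 2 * (t + 1) + 1 by omega, morphSeq_odd, h]; rfl⟩
      · exact ⟨1, by omega, by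
          rw [show 2 * t + 1 + 1 = 2 * (t + 1) by omega, morphSeq_even, h]⟩
  · intro p q hpq hq
    by_contra! heq
    -- after a shift by `r` the first window starts at an even position
    obtain ⟨r, p', hr, hp⟩ : ∃ r p', r ≤ 1 ∧ p + r = 2 * p' := ⟨p % 2, (p + p % 2) / 2, by omega⟩
    have he : ∀ x < l, morphSeq b (2 * p' + 2 * x) = morphSeq b (q + r + 2 * x) := by
      intro x hx
      have := heq (r + 2 * x) (by omega)
      rwa [← Nat.add_assoc, ← Nat.add_assoc, hp] at this
    have ho : ∀ x < l, morphSeq b (2 * p' + 2 * x + 1) = morphSeq b (q + r + 2 * x + 1) := by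
      intro x hx
      have := heq (r + 2 * x + 1) (by omega)
      rwa [← Nat.add_assoc, ← Nat.add_assoc, ← Nat.add_assoc, ← Nat.add_assoc, hp] at this
    obtain ⟨q', hq' | hq'⟩ : ∃ q', q + r = 2 * q' ∨ q + r = 2 * q' + 1 := ⟨(q + r) / 2, by omega⟩
    · obtain ⟨x, hx, hne⟩ := hb p' q' (by omega) (by omega)
      have := he x hx
      rw [hq', ← Nat.mul_add, ← Nat.mul_add, morphSeq_even, morphSeq_even] at this
      exact hne this
    · obtain ⟨x, hx, hne⟩ := hb q' (q' + 1) (by omega) (by omega)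
      have h1 := he x hx
      have h2 := ho x hx
      rw [hq', ← Nat.mul_add, show 2 * q' + 1 + 2 * x = 2 * (q' + x) + 1 by ring, morphSeq_even,
        morphSeq_odd] at h1
      rw [hq', ← Nat.mul_add, show 2 * q' + 1 + 2 * x + 1 = 2 * (q' + 1 + x) by ring,
        morphSeq_even, morphSeq_odd, h1, Bool.not_not] at h2
      exact hne h2

/-- The windows of a De Bruijn sequence are distinct: there are as many cyclic positions as words
of length `n`, and every word occurs. -/
theorem IsDeBruijn.distinct {n : ℕ} {B : List Bool} (hB : IsDeBruijn n B) (hn : 1 ≤ n) {p q : ℕ}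
    (hpq : p < q) (hq : q + n ≤ B.length) :
    ∃ x < n, B.getD (p + x) false ≠ B.getD (q + x) false := by
  obtain ⟨hlen, hB⟩ := hB
  let F : Fin (2 ^ n) → Fin n → Bool := fun i x => B.getD ((i + x) % 2 ^ n) false
  have hsurj : Function.Surjective F := by
    intro u
    obtain ⟨i, hi, h⟩ : ∃ i < 2 ^ n, ∀ x : Fin n, B.getD ((i + x) % 2 ^ n) false = u x := by
      have hul : (List.ofFn u).length = n := by simp
      have hget : ∀ x : Fin n, u x = (List.ofFn u).getD x false := by
        intro x
        simp [List.getD_eq_getElem?_getD]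
      rcases hB (List.ofFn u) hul with ⟨s, t, h⟩ | ⟨y, z, ⟨s, hs⟩, ⟨t, ht⟩, h⟩
      · have hl := congrArg List.length h
        simp only [List.length_append, hul, hlen] at hl
        refine ⟨s.length, by omega, fun x => ?_⟩
        have hx := x.2
        rw [Nat.mod_eq_of_lt (by omega), hget, ← h, List.append_assoc, List.getD_append_right,
          Nat.add_sub_cancel_left, List.getD_append]
        · omega
        · omega
      · have hl := congrArg List.length h
        have hls := congrArg List.length hs
        have hlt := congrArg List.length ht
        simp only [List.length_append, hul, hlen] at hl hls hlt
        by_cases hy : y.length = 0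
        · obtain rfl := List.length_eq_zero_iff.1 hy
          refine ⟨0, by positivity, fun x => ?_⟩
          have hx := x.2
          rw [Nat.zero_add, Nat.mod_eq_of_lt (by simp at hl; omega), hget, h, ← ht,
            List.nil_append, List.getD_append]
          simp at hl
          omega
        · refine ⟨s.length, by omega, fun x => ?_⟩
          have hx := x.2
          rw [hget, h]
          rcases Nat.lt_or_ge x y.length with hxy | hxy
          · rw [Nat.mod_eq_of_lt (by omega), ← hs, List.getD_append_right _ _ _ _ (by omega),
              Nat.add_sub_cancel_left, List.getD_append _ _ _ _ hxy]
          · have : (s.length + x) % 2 ^ n = x - y.length := by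
              rw [show s.length + x = (x - y.length) + 2 ^ n by omega, Nat.add_mod_right,
                Nat.mod_eq_of_lt (by omega)]
            rw [this, List.getD_append_right _ _ _ _ hxy]
            nth_rewrite 1 [← ht]
            rw [List.getD_append _ _ _ _ (by omega)]
    exact ⟨⟨i, hi⟩, funext h⟩
  have hinj : Function.Injective F :=
    ((Fintype.bijective_iff_surjective_and_card F).2 ⟨hsurj, by simp⟩).1
  by_contra! heq
  have : F ⟨p, by omega⟩ = F ⟨q, by omega⟩ := by
    funext x
    have hx := x.2
    simp only [F]
    rw [Nat.mod_eq_of_lt (by omega), Nat.mod_eq_of_lt (by omega)]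
    exact heq x hx
  have := congrArg Fin.val (hinj this)
  simp at this
  omega

/-- An explicit sequence with distinct windows, consisting of blocks of length `2 * m + 3`. The
`j`-th block is `110` followed by `c0` for each of the `m` digits `c` of `j`. -/
def counterSeq (m t : ℕ) : Bool :=
  if t % (2 * m + 3) ≤ 1 then true
  else t % (2 * m + 3) % 2 == 1 && (t / (2 * m + 3)).testBit ((t % (2 * m + 3) - 3) / 2)

/-- The factor `11` marks the beginning of a block. -/
theorem mod_eq_zero_of_counterSeq {m t : ℕ} (h1 : counterSeq m t = true)
    (h2 : counterSeq m (t + 1) = true) : t % (2 * m + 3) = 0 := by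
  have hlt := Nat.mod_lt t (show 0 < 2 * m + 3 by omega)
  by_contra h0
  have h3 : (t + 1) % (2 * m + 3) =
      if t % (2 * m + 3) + 1 = 2 * m + 3 then 0 else t % (2 * m + 3) + 1 := by
    rw [Nat.add_mod, Nat.mod_eq_of_lt (show 1 < 2 * m + 3 by omega)]
    split_ifs with h
    · rw [h, Nat.mod_self]
    · exact Nat.mod_eq_of_lt (by omega)
  unfold counterSeq at h1 h2
  rw [h3] at h2
  generalize t % (2 * m + 3) = s at *
  split_ifs at h1 h2 <;> simp at h1 h2 <;> omega

theorem counterSeq_mul_add {m i : ℕ} (j : ℕ) (hi : i < m) :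
    counterSeq m ((2 * m + 3) * j + (3 + 2 * i)) = j.testBit i := by
  have h1 : ((2 * m + 3) * j + (3 + 2 * i)) % (2 * m + 3) = 3 + 2 * i := by
    rw [Nat.mul_add_mod, Nat.mod_eq_of_lt (by omega)]
  have h2 : ((2 * m + 3) * j + (3 + 2 * i)) / (2 * m + 3) = j := by
    rw [Nat.mul_add_div (by omega), Nat.div_eq_of_lt (by omega), Nat.add_zero]
  have h3 : (3 + 2 * i) % 2 = 1 := by omega
  have h5 : ¬ 3 + 2 * i ≤ 1 := by omega
  simp [counterSeq, h1, h2, h3, h5]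

theorem counterSeq_distinct {m p q : ℕ} (hpq : p < q) (hq : q + 2 * (2 * m + 3) ≤ 2 ^ m) :
    ∃ x < 2 * (2 * m + 3), counterSeq m (p + x) ≠ counterSeq m (q + x) := by
  by_contra! heq
  obtain ⟨x, j, hx, hj⟩ : ∃ x j, x < 2 * m + 3 ∧ p + x = (2 * m + 3) * j := by
    have h1 := Nat.mod_lt (p + (2 * m + 2)) (show 0 < 2 * m + 3 by omega)
    have h2 := Nat.div_add_mod (p + (2 * m + 2)) (2 * m + 3)
    exact ⟨2 * m + 2 - (p + (2 * m + 2)) % (2 * m + 3), (p + (2 * m + 2)) / (2 * m + 3),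
      by omega, by omega⟩
  have h11 : ∀ y ≤ 1, counterSeq m (q + (x + y)) = true := by
    intro y hy
    rw [← heq (x + y) (by omega), ← Nat.add_assoc, hj]
    have : ((2 * m + 3) * j + y) % (2 * m + 3) = y := by
      rw [Nat.mul_add_mod, Nat.mod_eq_of_lt (by omega)]
    simp [counterSeq, this, hy]
  obtain ⟨j', hj'⟩ := Nat.dvd_of_mod_eq_zero
    (mod_eq_zero_of_counterSeq (h11 0 (by omega)) (h11 1 (by omega)))
  rw [Nat.add_zero] at hj'
  have hlt : j < j' := by
    by_contra hc
    have := Nat.mul_le_mul_left (2 * m + 3) (not_lt.1 hc)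
    omega
  have hlt' : j' < 2 ^ m := by
    have := Nat.mul_le_mul_right j' (show 1 ≤ 2 * m + 3 by omega)
    omega
  refine hlt.ne (Nat.eq_of_testBit_eq fun i => ?_)
  rcases Nat.lt_or_ge i m with hi | hi
  · have := heq (x + (3 + 2 * i)) (by omega)
    rwa [← Nat.add_assoc p x, ← Nat.add_assoc q x, hj, hj', counterSeq_mul_add _ hi,
      counterSeq_mul_add _ hi] at this
  · rw [Nat.testBit_lt_two_pow (hlt.trans (hlt'.trans_le (Nat.pow_le_pow_right (by omega) hi))),
      Nat.testBit_lt_two_pow (hlt'.trans_le (Nat.pow_le_pow_right (by omega) hi))]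

/-! ### The words `s_k` as words of unary blocks -/

theorem morph_map_range (b : ℕ → Bool) (k : ℕ) :
    morph ((List.range k).map b) = (List.range (2 * k)).map (morphSeq b) := by
  induction k with
  | zero => rfl
  | succ k ih =>
    unfold morph at ih ⊢
    rw [List.range_succ, List.map_append, List.flatMap_append, ih, Nat.mul_succ,
      List.range_succ, List.range_succ]
    simp [morphSeq_even, morphSeq_odd]

theorem binVal_map_range (f : ℕ → Bool) (n : ℕ) : binVal ((List.range n).map f) = bitVal f n := by
  induction n with
  | zero => rfl
  | succ n ih =>
    unfold binVal at ih ⊢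
    rw [List.range_succ, List.map_append, List.foldl_append, ih, bitVal]
    rfl

theorem sWord_eq_blockWord {k : ℕ} (hk : 1 ≤ k) {B : List Bool} (hB : k ≤ B.length) :
    sWord k B = blockWord
      ((List.range (k - 1)).map (blockLen (morphSeq fun t => B.getD t false) k))
      (blockLen (morphSeq fun t => B.getD t false) k (k - 1)) := by
  have h1 : B.take k = (List.range k).map fun t => B.getD t false := by
    refine List.ext_getElem (by simp [hB]) fun i h1 h2 => ?_
    simp at h1
    simp [List.getD_eq_getElem?_getD, h1.2]
  have h2 : wWord k B = (List.range (2 * k)).map (morphSeq fun t => B.getD t false) := by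
    rw [wWord, h1, morph_map_range]
  have h3 : ∀ i < k, binVal ((wWord k B).take (k + (i + 1))) =
      blockLen (morphSeq fun t => B.getD t false) k i := by
    intro i hi
    rw [h2, ← List.map_take, List.take_range, min_eq_left (by omega), binVal_map_range, blockLen]
  have h4 : binVal (wWord k B) = blockLen (morphSeq fun t => B.getD t false) k (k - 1) := by
    rw [← h3 (k - 1) (by omega), List.take_of_length_le]
    rw [h2]
    simp
    omega
  rw [sWord, blockWord, h4, List.flatMap_map]
  congr 1
  refine List.flatMap_congr fun i hi => ?_
  rw [List.mem_range] at hi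
  rw [h3 i (by omega)]

theorem length_blockWord (ms : List ℕ) (m : ℕ) :
    (blockWord ms m).length = (ms.map (· + 1)).sum + m := by
  simp [blockWord, aBlock, List.length_flatMap]

section Length

variable {f : ℕ → Bool} {k : ℕ}

theorem length_blockWord_blockLen_le (hk : 1 ≤ k) :
    (blockWord ((List.range (k - 1)).map (blockLen f k)) (blockLen f k (k - 1))).length ≤
      2 * 4 ^ k := by
  have key : ∀ n, (((List.range n).map (blockLen f k)).map (· + 1)).sum ≤ 2 ^ (k + n + 1) := by
    intro n
    induction n with
    | zero => simp
    | succ n ih =>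
      have h1 : blockLen f k n < 2 ^ (k + n + 1) := bitVal_lt f (k + (n + 1))
      have h2 : 2 ^ (k + (n + 1) + 1) = 2 ^ (k + n + 1) * 2 := pow_succ 2 (k + n + 1)
      rw [List.range_succ, List.map_append, List.map_append, List.sum_append, h2]
      simp only [List.map_cons, List.map_nil, List.sum_cons, List.sum_nil]
      omega
  rw [length_blockWord]
  have h1 := key (k - 1)
  have h2 := bitVal_lt f (k + (k - 1 + 1))
  have h3 : (2 : ℕ) ^ (k + (k - 1) + 1) = 4 ^ k := by
    rw [show k + (k - 1) + 1 = 2 * k by omega, pow_mul]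
    norm_num
  rw [h3] at h1
  rw [← Nat.add_assoc, h3, Nat.add_assoc] at h2
  unfold blockLen at *
  omega

theorem four_pow_le_length_blockWord (hf : f 0 = true) (hk : 1 ≤ k) (ms : List ℕ) :
    4 ^ k ≤ 2 * (blockWord ms (blockLen f k (k - 1))).length := by
  have h1 := le_bitVal hf (k + (k - 1))
  have h2 : (2 : ℕ) ^ (k + (k - 1)) * 2 = 4 ^ k := by
    rw [← pow_succ, show k + (k - 1) + 1 = 2 * k by omega, pow_mul]
    norm_num
  rw [length_blockWord, blockLen, ← Nat.add_assoc]
  omega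

theorem smallestSize_blockWord_blockLen_le (hf : f 0 = true) (hk : 1 ≤ k) {vs : List (List (Fin 2))}
    {s : ℕ} (h : Build vs s) {ps : List ℕ} (hps : ∀ r ∈ ps, aBlock r ∈ vs) :
    smallestSize (blockWord (ps ++ (List.range (k - 1)).map (blockLen f k))
      (blockLen f k (k - 1))) ≤ s + 8 * k + 2 * ps.length := by
  obtain ⟨vs', s', hb, hs, hv, hm⟩ := h.exists_bitVal hf (2 * k)
  refine (hb.smallestSize_blockWord_le ?_ (hm _ (by omega) (by omega))).trans ?_
  · intro i hi
    rcases List.mem_append.1 hi with hi | hi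
    · exact hv (hps i hi)
    · obtain ⟨j, hj, rfl⟩ := List.mem_map.1 hi
      rw [List.mem_range] at hj
      exact hm _ (by omega) (by omega)
  · rw [List.length_append, List.length_map, List.length_range]
    omega

end Length

/-! ### Asymptotics -/

theorem eight_mul_clog_two_add_le (k : ℕ) (hk : 3 ≤ k) :
    (8 * Nat.clog 2 k + 17 : ℝ) ≤ 37 * Real.log k := by
  have hk' : (3 : ℝ) ≤ k := by exact_mod_cast hk
  have h1 : 1 ≤ Real.log k := by
    rw [Real.le_log_iff_exp_le (by linarith)]
    exact Real.exp_one_lt_d9.le.trans (by linarith)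
  have h2 : 2 ^ (Nat.clog 2 k - 1) < k := Nat.pow_pred_clog_lt_self (by norm_num) (by omega)
  have h3 : 1 ≤ Nat.clog 2 k := Nat.clog_pos (by norm_num) (by omega)
  have h4 : ((Nat.clog 2 k - 1 : ℕ) : ℝ) * Real.log 2 ≤ Real.log k := by
    rw [← Real.log_pow]
    exact Real.log_le_log (by positivity) (by exact_mod_cast h2.le)
  rw [Nat.cast_sub h3, Nat.cast_one] at h4
  have h5 := Real.log_two_gt_d9
  have h6 : (1 : ℝ) ≤ Nat.clog 2 k := by exact_mod_cast h3
  nlinarith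

theorem mul_div_clog_ge {k : ℕ} (hk : 21904 ≤ k) :
    1 / 148 * ((k : ℝ) ^ 2 / Real.log k) ≤
      (((k - 1) * (k / (8 * Nat.clog 2 k + 17)) : ℕ) : ℝ) := by
  have hk' : (21904 : ℝ) ≤ k := by exact_mod_cast hk
  set D := 8 * Nat.clog 2 k + 17 with hD
  have hD1 : (D : ℝ) ≤ 37 * Real.log k := by
    have := eight_mul_clog_two_add_le k (by omega)
    simpa [hD] using this
  have hD0 : (0 : ℝ) < D := by
    have : 0 < D := by omega
    exact_mod_cast this
  have hlog : 0 < Real.log k := by linarith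
  -- `log k ≤ 2 √k ≤ k / 74`
  have hsmall : 74 * Real.log k ≤ k := by
    have h1 : Real.sqrt k ^ 2 = k := Real.sq_sqrt (by linarith)
    have h2 : Real.log k = 2 * Real.log (Real.sqrt k) := by
      rw [Real.log_sqrt (by linarith)]
      ring
    have h3 : (148 : ℝ) ≤ Real.sqrt k := Real.le_sqrt_of_sq_le (by linarith)
    have h4 := Real.log_le_self (Real.sqrt_nonneg k)
    nlinarith
  have hfloor : (k : ℝ) / D - 1 ≤ ((k / D : ℕ) : ℝ) := by
    have h1 : k < D * (k / D + 1) := Nat.lt_mul_div_succ k (by omega)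
    have h2 : (k : ℝ) < D * ((k / D : ℕ) + 1) := by exact_mod_cast h1
    rw [sub_le_iff_le_add, div_le_iff₀ hD0]
    linarith
  have hdiv : (k : ℝ) / (74 * Real.log k) ≤ (k : ℝ) / D - 1 := by
    have h1 : (k : ℝ) / (37 * Real.log k) ≤ k / D :=
      div_le_div_of_nonneg_left (by linarith) hD0 hD1
    have h2 : (k : ℝ) / (37 * Real.log k) = 2 * (k / (74 * Real.log k)) := by
      field_simp
      norm_num
    have h3 : 1 ≤ (k : ℝ) / (74 * Real.log k) := by
      rw [le_div_iff₀ (by positivity)]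
      linarith
    linarith
  have hk1 : (k : ℝ) / 2 ≤ ((k - 1 : ℕ) : ℝ) := by
    rw [Nat.cast_sub (by omega), Nat.cast_one]
    linarith
  have hq : 0 ≤ (k : ℝ) / (74 * Real.log k) := by positivity
  rw [Nat.cast_mul]
  calc 1 / 148 * ((k : ℝ) ^ 2 / Real.log k) = k / 2 * (k / (74 * Real.log k)) := by
        field_simp
        norm_num
    _ ≤ _ := mul_le_mul hk1 (hdiv.trans hfloor) hq (by positivity)

theorem output_sWord_size_ge {k : ℕ} (hk : 21904 ≤ k) {B : List Bool}
    (hB : IsDeBruijn (Nat.clog 2 k) B) (hB1 : B.head? = some true) {v : Variant}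
    {G : Grammar (Fin 2)} (hG : v.Output (sWord k B) G) :
    1 / 148 * ((k : ℝ) ^ 2 / Real.log k) ≤ G.size := by
  have hlen : k ≤ B.length := hB.1 ▸ Nat.le_pow_clog (by norm_num) k
  have hm : 1 ≤ Nat.clog 2 k := Nat.clog_pos (by norm_num) (by omega)
  set m := Nat.clog 2 k with hmdef
  rw [sWord_eq_blockWord (by omega) hlen] at hG
  have hf := hasDistinctWindows_morphSeq (b := fun t => B.getD t false) (k := k) (l := m)
    fun p q hpq hq => hB.distinct hm hpq (hq.trans hlen)
  have hf0 : morphSeq (fun t => B.getD t false) 0 = true := by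
    cases B with
    | nil => simp at hB1
    | cons c B => simpa [morphSeq] using hB1
  have h1 := hf.output_size_ge (by omega) hf0 (by omega) (ps := []) (by simp) (v := v) (G := G)
    (by simpa using hG)
  refine (mul_div_clog_ge hk).trans ?_
  have h2 : k / (8 * m + 17) ≤ k / (2 * m + 1 + 4) :=
    Nat.div_le_div_left (by omega) (by omega)
  exact_mod_cast (Nat.mul_le_mul_left (k - 1) h2).trans h1

/-- Words of every length `n` between `4^(k+1)` and `4^(k+2)` with small grammars and large
outputs: a unary block in front of a word like `s_k` adjusts the length. -/
theorem exists_padded_word {k n : ℕ} (hk : 21904 ≤ k) (hn : 4 ^ (k + 1) ≤ n)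
    (hn' : n < 4 ^ (k + 2)) :
    ∃ w : List (Fin 2), w.length = n ∧ smallestSize w ≤ 28 * k ∧
      ∀ (v : Variant) (G : Grammar (Fin 2)), v.Output w G →
        1 / 148 * ((k : ℝ) ^ 2 / Real.log k) ≤ G.size := by
  set m := Nat.clog 2 k with hmdef
  set f := morphSeq (counterSeq m) with hfdef
  have hf := hasDistinctWindows_morphSeq (b := counterSeq m) (k := k) (l := 2 * (2 * m + 3))
    fun p q hpq hq => counterSeq_distinct hpq (hq.trans (Nat.le_pow_clog (by norm_num) k))
  have hf0 : f 0 = true := by simp [hfdef, morphSeq, counterSeq]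
  have hlen := length_blockWord_blockLen_le (f := f) (k := k) (by omega)
  set S := (blockWord ((List.range (k - 1)).map (blockLen f k)) (blockLen f k (k - 1))).length
    with hS
  have h4 : (4 : ℕ) ^ (k + 1) = 4 * 4 ^ k := by rw [pow_succ, mul_comm]
  have hpos : 0 < 4 ^ k := by positivity
  set r := n - S - 1 with hr
  refine ⟨blockWord ([r] ++ (List.range (k - 1)).map (blockLen f k)) (blockLen f k (k - 1)),
    ?_, ?_, ?_⟩
  · rw [length_blockWord] at hS ⊢
    rw [List.map_append, List.sum_append]
    simp only [List.map_cons, List.map_nil, List.sum_cons, List.sum_nil]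
    omega
  · have hr2 : r < 2 ^ (2 * k + 4) := by
      have : (4 : ℕ) ^ (k + 2) = 2 ^ (2 * k + 4) := by
        rw [show 2 * k + 4 = 2 * (k + 2) by omega, pow_mul]
        norm_num
      omega
    obtain ⟨vs, s, hb, hs, -, hrv⟩ := Build.nil.exists_aBlock (r := r) (by omega) hr2
    have := smallestSize_blockWord_blockLen_le hf0 (k := k) (by omega) hb (ps := [r])
      (by simpa using hrv)
    simp only [List.length_singleton] at this
    omega
  · intro v G hG
    have h1 := hf.output_size_ge (by omega) hf0 (by omega) (by simp) hG
    refine (mul_div_clog_ge hk).trans ?_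
    rw [show 2 * (2 * (2 * m + 3)) + 1 + 4 = 8 * m + 17 by omega] at h1
    exact_mod_cast h1

/-- The constant is `1 / (148 * 28 * 4)`, from the bounds in `exists_padded_word` and
`log n ≤ 4 * k`. -/
theorem approxRatio_ge {v : Variant} {C : List (Fin 2) → Grammar (Fin 2)} (hC : v.Implements C)
    {n : ℕ} (hn : 21905 ≤ Nat.log 4 n) :
    1 / 16576 * (Real.log n / Real.log (Real.log n)) ≤ approxRatio C n := by
  have hn0 : n ≠ 0 := by
    rintro rfl
    simp at hn
  obtain ⟨k, hk⟩ : ∃ k, Nat.log 4 n = k + 1 :=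
    ⟨Nat.log 4 n - 1, by omega⟩
  have hk21 : 21904 ≤ k := by omega
  have h1 : 4 ^ (k + 1) ≤ n := hk ▸ Nat.pow_log_le_self 4 hn0
  have h2 : n < 4 ^ (k + 2) := by
    have := Nat.lt_pow_succ_log_self (b := 4) (by norm_num) n
    rwa [hk] at this
  obtain ⟨w, hw, hg, hG⟩ := exists_padded_word hk21 h1 h2
  have hwne : w ≠ [] := by
    rintro rfl
    exact hn0 hw.symm
  have hsize := hG v _ (hC w hwne)
  have hg0 : (0 : ℝ) < smallestSize w := by exact_mod_cast smallestSize_pos hwne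
  have hg' : (smallestSize w : ℝ) ≤ 28 * k := by exact_mod_cast hg
  have hk' : (21904 : ℝ) ≤ k := by exact_mod_cast hk21
  have hlogk : 0 < Real.log k := Real.log_pos (by linarith)
  have hratio : ((C w).size : ℝ) / smallestSize w ≤ approxRatio C n := by
    have := le_ciSup (f := fun w : List.Vector (Fin 2) n =>
      ((C w.toList).size : ℝ) / (smallestSize w.toList : ℝ)) (Set.finite_range _).bddAbove ⟨w, hw⟩
    exact this
  have hlog4 : Real.log 4 = 2 * Real.log 2 := by
    rw [show (4 : ℝ) = 2 ^ 2 by norm_num, Real.log_pow]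
    norm_num
  have hl1 := Real.log_two_gt_d9
  have hl2 := Real.log_two_lt_d9
  have hupper : Real.log n ≤ 4 * k := by
    have h3 : Real.log n ≤ Real.log ((4 : ℝ) ^ (k + 2)) :=
      Real.log_le_log (by positivity) (by exact_mod_cast h2.le)
    rw [Real.log_pow, hlog4] at h3
    push_cast at h3
    nlinarith
  have hlower : (k : ℝ) ≤ Real.log n := by
    have h3 : Real.log ((4 : ℝ) ^ (k + 1)) ≤ Real.log n :=
      Real.log_le_log (by positivity) (by exact_mod_cast h1)
    rw [Real.log_pow, hlog4] at h3
    push_cast at h3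
    nlinarith
  have hloglog : Real.log k ≤ Real.log (Real.log n) := Real.log_le_log (by linarith) hlower
  refine le_trans ?_ hratio
  calc 1 / 16576 * (Real.log n / Real.log (Real.log n))
      ≤ 1 / 16576 * (4 * k / Real.log k) := by
        gcongr
    _ = 1 / 148 * ((k : ℝ) ^ 2 / Real.log k) / (28 * k) := by
        field_simp
        norm_num
    _ ≤ (C w).size / smallestSize w := by
        gcongr

end RePair

open RePair in
theorem theorem4 :
    -- the length of `s_k` is `Θ(4^k)`, and its smallest straight-line program has size `O(k)`
    (∃ c₁ c₂ : ℝ, 0 < c₁ ∧ 0 < c₂ ∧ ∃ K : ℕ, ∀ k : ℕ, 1 ≤ k →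
      ∀ B : List Bool, IsDeBruijn (Nat.clog 2 k) B → B.head? = some true →
        c₁ * 4 ^ k ≤ ((sWord k B).length : ℝ) ∧ ((sWord k B).length : ℝ) ≤ c₂ * 4 ^ k ∧
          smallestSize (sWord k B) ≤ K * k) ∧
    ∀ v : Variant,
      -- on every non-empty binary word the algorithm has an output, which is an SLP for the word
      (∃ C : List (Fin 2) → Grammar (Fin 2), v.Implements C) ∧
      (∀ C : List (Fin 2) → Grammar (Fin 2), v.Implements C → IsCompressor C) ∧
      -- every output on `s_k` has size `Ω(k² / log k)`
      (∃ c : ℝ, 0 < c ∧ ∃ k₀ : ℕ, ∀ k : ℕ, k₀ ≤ k →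
        ∀ B : List Bool, IsDeBruijn (Nat.clog 2 k) B → B.head? = some true →
          ∀ G : Grammar (Fin 2), v.Output (sWord k B) G →
            c * ((k : ℝ) ^ 2 / Real.log k) ≤ (G.size : ℝ)) ∧
      -- the worst-case approximation ratio on binary words is `Ω(log n / log log n)`
      (∃ c : ℝ, 0 < c ∧ ∃ n₀ : ℕ, ∀ C : List (Fin 2) → Grammar (Fin 2), v.Implements C →
        ∀ n : ℕ, n₀ ≤ n →
          c * (Real.log n / Real.log (Real.log n)) ≤ approxRatio C n) := by
  obtain ⟨n₀, hn₀⟩ : ∃ n₀, ∀ n, n₀ ≤ n → 21905 ≤ Nat.log 4 n := by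
    generalize 21905 = K
    exact ⟨4 ^ K, fun n hn => Nat.le_log_of_pow_le (by norm_num) hn⟩
  refine ⟨⟨1 / 2, 2, by norm_num, by norm_num, 8, fun k hk B hB hB1 => ?_⟩, fun v =>
    ⟨v.exists_implements, fun C hC => hC.isCompressor,
      ⟨1 / 148, by norm_num, 21904, fun k hk B hB hB1 G hG => output_sWord_size_ge hk hB hB1 hG⟩,
      ⟨1 / 16576, by norm_num, n₀, fun C hC n hn => approxRatio_ge hC (hn₀ n hn)⟩⟩⟩
  have hf0 : morphSeq (fun t => B.getD t false) 0 = true := by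
    cases B with
    | nil => simp at hB1
    | cons c B => simpa [morphSeq] using hB1
  rw [sWord_eq_blockWord hk (hB.1 ▸ Nat.le_pow_clog (by norm_num) k)]
  refine ⟨?_, ?_, ?_⟩
  · have : ((4 ^ k : ℕ) : ℝ) ≤ _ := Nat.cast_le.2 (four_pow_le_length_blockWord hf0 hk
      ((List.range (k - 1)).map (blockLen (morphSeq fun t => B.getD t false) k)))
    push_cast at this
    linarith
  · exact_mod_cast length_blockWord_blockLen_le hk
  · simpa using smallestSize_blockWord_blockLen_le hf0 hk Build.nil (ps := []) (by simp)
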